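/- Let $N\ge 3$. All functions are real valued and are identified when they agree almost everywhere. Let $D^{1,2}(\mathbb{R}^N)$ be the set of $u\in L^{\frac{2N}{N-2}}(\mathbb{R}^N)$ whose weak gradient $\nabla u$ belongs to $L^2(\mathbb{R}^N)$, and let $$E=\Big\{u\in D^{1,2}(\mathbb{R}^N):\ \int_{\mathbb{R}^N}\int_{\mathbb{R}^N}\frac{u^2(x)\,u^2(y)}{|x-y|^{N-2}}\,dx\,dy<+\infty\Big\}.$$ Let $E_r$ be the set of radial functions in $E$, let $C_0^\infty(\mathbb{R}^N)$ be the set of smooth functions with compact support, and let $C_{0,r}^\infty(\mathbb{R}^N)$ be the set of radial functions in $C_0^\infty(\mathbb{R}^N)$. For $u\in E$ define $$\|u\|_E=\left(\int_{\mathbb{R}^N}|\nabla u(x)|^2\,dx+\left(\int_{\mathbb{R}^N}\int_{\mathbb{R}^N}\frac{u^2(x)\,u^2(y)}{|x-y|^{N-2}}\,dx\,dy\right)^{1/2}\right)^{1/2}.$$ Then $E$ is a vector space, $\|\cdot\|_E$ is a norm on $E$, and $(E,\|\cdot\|_E)$ is a uniformly convex Banach space. Moreover, $C_0^\infty(\mathbb{R}^N)$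 is contained and dense in $E$, and $C_{0,r}^\infty(\mathbb{R}^N)$ is contained and dense in $E_r$. -/

import Mathlib

open MeasureTheory Filter
open scoped ENNReal ContDiff

/-- `ℝ^N` with the Euclidean norm. -/
abbrev Space (N : ℕ) : Type := EuclideanSpace ℝ (Fin N)

/-- `C_0^∞(ℝ^N)`: smooth functions with compact support. -/
def IsTestFunction {N : ℕ} (φ : Space N → ℝ) : Prop :=
  ContDiff ℝ ∞ φ ∧ HasCompactSupport φ

/-- `f(x)` depends only on `|x|`. -/
def IsRadial {N : ℕ} (f : Space N → ℝ) : Prop :=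
  ∃ h : ℝ → ℝ, ∀ x, f x = h ‖x‖

/-- `g` is a weak (distributional) gradient of `u`: both are locally integrable and
`∫ u ∂_v φ = - ∫ (g · v) φ` for every test function `φ` and every direction `v`. -/
structure IsWeakGradient {N : ℕ} (u : Space N → ℝ) (g : Space N → Space N) : Prop where
  locallyIntegrable : LocallyIntegrable u
  locallyIntegrable_grad : LocallyIntegrable g
  integral_eq : ∀ φ : Space N → ℝ, IsTestFunction φ → ∀ v : Space N,
    ∫ x, u x * fderiv ℝ φ x v = - ∫ x, inner ℝ (g x) v * φ x

/-- A weak gradient is unique up to null sets. -/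
theorem IsWeakGradient.ae_eq {N : ℕ} {u : Space N → ℝ} {g₁ g₂ : Space N → Space N}
    (h₁ : IsWeakGradient u g₁) (h₂ : IsWeakGradient u g₂) : g₁ =ᵐ[volume] g₂ := by
  refine ae_eq_of_integral_contDiff_smul_eq h₁.locallyIntegrable_grad
    h₂.locallyIntegrable_grad fun φ hφ hc => ?_
  have key : ∀ {g : Space N → Space N}, LocallyIntegrable g → ∀ v : Space N,
      inner ℝ (∫ x, φ x • g x) v = ∫ x, inner ℝ (g x) v * φ x := by
    intro g hg v
    have hi : Integrable (fun x => φ x • g x) :=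
      hg.integrable_smul_left_of_hasCompactSupport hφ.continuous hc
    rw [real_inner_comm, ← integral_inner hi]
    refine integral_congr_ae (Eventually.of_forall fun x => ?_)
    simp only [inner_smul_right]
    rw [real_inner_comm, mul_comm]
  refine ext_inner_right ℝ fun v => ?_
  rw [key h₁.locallyIntegrable_grad, key h₂.locallyIntegrable_grad]
  have e₁ := h₁.integral_eq φ ⟨hφ, hc⟩ v
  have e₂ := h₂.integral_eq φ ⟨hφ, hc⟩ v
  linarith

open Classical in
/-- The weak gradient `∇u` (zero if `u` has none); well defined up to null sets by
`IsWeakGradient.ae_eq`. -/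
noncomputable def weakGrad {N : ℕ} (u : Space N → ℝ) : Space N → Space N :=
  if h : ∃ g, IsWeakGradient u g then h.choose else 0

/-- `u ∈ D^{1,2}(ℝ^N)`, for `N ≥ 3`: `u ∈ L^{2N/(N-2)}` has a weak gradient in `L^2`. -/
def MemD12 {N : ℕ} (u : Space N → ℝ) : Prop :=
  MemLp u (ENNReal.ofReal (2 * (N : ℝ) / ((N : ℝ) - 2))) ∧
    ∃ g, IsWeakGradient u g ∧ MemLp g 2

/-- The Coulomb energy `D(u²,u²) = ∫∫ u²(x) u²(y) / |x-y|^{N-2} dx dy ∈ [0,∞]`, for `N ≥ 3`. -/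
noncomputable def coulombEnergy {N : ℕ} (u : Space N → ℝ) : ℝ≥0∞ :=
  ∫⁻ x, ∫⁻ y, ENNReal.ofReal (u x ^ 2 * u y ^ 2 / ‖x - y‖ ^ (N - 2))

/-- `∫ |∇u|² dx ∈ [0,∞]`. -/
noncomputable def gradEnergy {N : ℕ} (u : Space N → ℝ) : ℝ≥0∞ :=
  ∫⁻ x, ENNReal.ofReal (‖weakGrad u x‖ ^ 2)

/-- `E(ℝ^N)`, as a set of classes of functions modulo equality almost everywhere. -/
def spaceE (N : ℕ) : Set (Space N →ₘ[volume] ℝ) :=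
  {u | MemD12 u ∧ coulombEnergy u < ⊤}

/-- `E_r(ℝ^N)`: the classes in `E(ℝ^N)` that have a radial representative. -/
def spaceEr (N : ℕ) : Set (Space N →ₘ[volume] ℝ) :=
  {u | u ∈ spaceE N ∧ ∃ f : Space N → ℝ, IsRadial f ∧ u =ᵐ[volume] f}

/-- `‖u‖_E = (∫ |∇u|² + D(u²,u²)^{1/2})^{1/2}`. Both energies are finite on `E`. -/
noncomputable def normE {N : ℕ} (u : Space N →ₘ[volume] ℝ) : ℝ :=
  Real.sqrt ((gradEnergy u).toReal + Real.sqrt (coulombEnergy u).toReal)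

/-- The classes of the functions in `C_0^∞(ℝ^N)`. -/
def testClasses (N : ℕ) : Set (Space N →ₘ[volume] ℝ) :=
  {u | ∃ φ : Space N → ℝ, IsTestFunction φ ∧ u =ᵐ[volume] φ}

/-- The classes of the radial functions in `C_0^∞(ℝ^N)`. -/
def radialTestClasses (N : ℕ) : Set (Space N →ₘ[volume] ℝ) :=
  {u | ∃ φ : Space N → ℝ, IsTestFunction φ ∧ IsRadial φ ∧ u =ᵐ[volume] φ}

/-! Everything rests on a Gaussian square root of the Coulomb kernel. The Gamma integral writes `‖x
- y‖ ^ (2 - N)` as a superposition in `t` of Gaussians `exp (-t ‖x - y‖²)`, and each Gaussian is an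
autocorrelation of narrower ones. Hence `D(u², u²)` is the integral over `w = (t, z)` of the square
of a weighted average `G_u(w)` of `u²`, with nonnegative weights
(`coulombEnergy_eq_lintegral_gaussAverage`). Its fourth root is thus a mixed norm, `L⁴` in `w` of a
weighted `L²` norm of `u`. Minkowski gives the triangle inequality, and the pointwise parallelogram
identity for `G` gives a Clarkson inequality of exponent 4.

The norm of `E` is the `ℓ²` combination of the Hilbert seminorm `‖∇u‖₂` and this Coulomb norm; the
parallelogram law for one and Clarkson for the other give uniform convexity
(`uniformConvexSpace_ofCore`).

For density, `u` is mollified and cut off. Neither operation increases the Coulomb energy, so almost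
everywhere convergence, Fatou and Clarkson give convergence in energy. The gradient splits by the
product rule into a term that converges in `L²` and a commutator, which Hölder and the tail of the
`L^{2N/(N-2)}` norm of `u` send to zero. Mollifiers and cutoffs are radial, so radial functions have
radial approximations.

This approximation of gradients also extends the Sobolev inequality from test functions to `E`.
Sobolev makes the norm definite and makes Cauchy sequences converge in `L^{2N/(N-2)}`; closedness of
the weak gradient and Fatou for the Coulomb energy then give completeness. -/

variable {N : ℕ}

/-! ### Uniform convexity of a combined norm -/

/-- A norm that is the `ℓ²` combination of a Hilbert seminorm `a` and a seminorm `b` which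
satisfies Clarkson's inequality with exponent `4` is uniformly convex. -/
theorem uniformConvexSpace_ofCore {V : Type*} [AddCommGroup V] [Module ℝ V] [Norm V]
    (core : NormedSpace.Core ℝ V) (a b : V → ℝ) (hb : ∀ u, 0 ≤ b u)
    (hab : ∀ u, ‖u‖ ^ 2 = a u ^ 2 + b u ^ 2)
    (par : ∀ u v, a (u + v) ^ 2 + a (u - v) ^ 2 = 2 * (a u ^ 2 + a v ^ 2))
    (tri : ∀ u v, b (u + v) ≤ b u + b v)
    (cla : ∀ u v, b (u + v) ^ 4 + b (u - v) ^ 4 ≤ 8 * (b u ^ 4 + b v ^ 4)) :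
    letI : NormedAddCommGroup V := NormedAddCommGroup.ofCore core
    UniformConvexSpace V := by
  let _ : NormedAddCommGroup V := NormedAddCommGroup.ofCore core
  refine ⟨fun ε hε => ?_⟩
  -- If `‖x - y‖ ≥ ε`, then `a (x - y) ^ 2` or `β = b (x - y) ^ 2` is at least `ε ^ 2 / 2`. The
  -- second case contributes only `β ^ 2 / 24`, whence `ε ^ 4 / 96`.
  set m : ℝ := min (ε ^ 2 / 2) (ε ^ 4 / 96) with hm
  have hm0 : 0 < m := by positivity
  refine ⟨m / 4, by positivity, fun x hx y hy hxy => ?_⟩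
  have hX : a x ^ 2 + b x ^ 2 = 1 := by rw [← hab, hx]; norm_num
  have hY : a y ^ 2 + b y ^ 2 = 1 := by rw [← hab, hy]; norm_num
  have hS := hab (x + y)
  have hD := hab (x - y)
  have hp := par x y
  have hD' : ε ^ 2 ≤ a (x - y) ^ 2 + b (x - y) ^ 2 := by
    rw [← hD]; gcongr
  have ht : b (x + y) ^ 2 ≤ (b x + b y) ^ 2 := by
    have := tri x y
    have := hb (x + y)
    gcongr
  have hc := cla x y
  set s := 2 * (b x ^ 2 + b y ^ 2) with hs
  set B := b (x + y) ^ 2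
  set β := b (x - y) ^ 2 with hβ
  have hβ0 : 0 ≤ β := by positivity
  have hB0 : 0 ≤ B := by positivity
  have h1 : (b x - b y) ^ 2 ≤ s - B := by
    have : (b x - b y) ^ 2 + (b x + b y) ^ 2 = s := by ring
    linarith
  have hbx : b x ≤ 1 := abs_le_of_sq_le_sq' (by linarith [sq_nonneg (a x)]) zero_le_one |>.2
  have hby : b y ≤ 1 := abs_le_of_sq_le_sq' (by linarith [sq_nonneg (a y)]) zero_le_one |>.2
  -- With `p = b x` and `q = b y`, `8 (p⁴ + q⁴) = s² + 4 (p² - q²)²`. The excess over `s²` carries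
  -- the factor `(p - q)²`, which the triangle inequality bounds by `s - B`.
  have hc' : B ^ 2 + β ^ 2 ≤ s ^ 2 + 4 * ((b x - b y) ^ 2 * (b x + b y) ^ 2) := by
    have e1 : B ^ 2 = b (x + y) ^ 4 := by ring
    have e2 : β ^ 2 = b (x - y) ^ 4 := by ring
    rw [e1, e2]
    refine hc.trans (le_of_eq ?_)
    rw [hs]; ring
  have h2 : (b x - b y) ^ 2 * (b x + b y) ^ 2 ≤ (s - B) * 4 := by
    have : (b x + b y) ^ 2 ≤ 4 := by
      have := pow_le_pow_left₀ (add_nonneg (hb x) (hb y)) (add_le_add hbx hby) 2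
      linarith
    gcongr
    exact (sq_nonneg _).trans h1
  have hs4 : s ≤ 4 := by linarith [sq_nonneg (a x), sq_nonneg (a y)]
  have hsB : 0 ≤ s - B := (sq_nonneg _).trans h1
  -- `24 = 8 + 16`: the 8 bounds `s + B`, the 16 comes from the excess in Clarkson's inequality.
  have h3 : β ^ 2 ≤ 24 * (s - B) := by
    have : (s + B) * (s - B) ≤ 8 * (s - B) := by
      gcongr
      linarith
    linarith
  -- By the parallelogram law for `a`, `‖x + y‖² = 4 - a (x - y)² - (s - B)`.
  have h4 : ‖x + y‖ ^ 2 ≤ 4 - (a (x - y) ^ 2 + β ^ 2 / 24) := by linarith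
  have h5 : m ≤ a (x - y) ^ 2 + β ^ 2 / 24 := by
    rcases le_total (ε ^ 2 / 2) (a (x - y) ^ 2) with h | h
    · exact (min_le_left _ _).trans (h.trans (by linarith [sq_nonneg β]))
    · refine (min_le_right _ _).trans ?_
      have : ε ^ 2 / 2 ≤ β := by linarith
      have := pow_le_pow_left₀ (by positivity) this 2
      linarith [sq_nonneg (a (x - y))]
  have h6 : ‖x + y‖ ^ 2 ≤ (2 - m / 4) ^ 2 := by linarith [sq_nonneg m]
  have h7 : m ≤ 4 := by linarith [sq_nonneg ‖x + y‖]
  exact abs_le_of_sq_le_sq' h6 (by linarith) |>.2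

/-- The `ℓ²` combination of two seminorms satisfies the triangle inequality. -/
theorem sqrt_add_sq_le_of_le {a b a₁ b₁ a₂ b₂ : ℝ} (ha : 0 ≤ a) (hb : 0 ≤ b)
    (hA : a ≤ a₁ + a₂) (hB : b ≤ b₁ + b₂) :
    √(a ^ 2 + b ^ 2) ≤ √(a₁ ^ 2 + b₁ ^ 2) + √(a₂ ^ 2 + b₂ ^ 2) := by
  have key : √((a₁ + a₂) ^ 2 + (b₁ + b₂) ^ 2) ≤ √(a₁ ^ 2 + b₁ ^ 2) + √(a₂ ^ 2 + b₂ ^ 2) := by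
    rw [Real.sqrt_le_left (by positivity)]
    have h1 := Real.sq_sqrt (show 0 ≤ a₁ ^ 2 + b₁ ^ 2 by positivity)
    have h2 := Real.sq_sqrt (show 0 ≤ a₂ ^ 2 + b₂ ^ 2 by positivity)
    have h3 : a₁ * a₂ + b₁ * b₂ ≤ √(a₁ ^ 2 + b₁ ^ 2) * √(a₂ ^ 2 + b₂ ^ 2) := by
      rw [← Real.sqrt_mul (by positivity)]
      exact Real.le_sqrt_of_sq_le (by nlinarith [sq_nonneg (a₁ * b₂ - a₂ * b₁)])
    nlinarith
  refine le_trans (Real.sqrt_le_sqrt ?_) key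
  gcongr

/-! ### Gaussian factorisation of the Coulomb kernel -/

/-- The square root, in the sense of convolution, of the Coulomb kernel: the Gaussians
`exp (-2 t ‖z‖²)`, weighted so that their autocorrelations integrate to `‖z‖ ^ (2 - N)`. -/
noncomputable def coulombRoot (w : ℝ × Space N) : ℝ≥0∞ :=
  ENNReal.ofReal (√(w.1 ^ (((N : ℝ) - 2) / 2 - 1) / Real.Gamma (((N : ℝ) - 2) / 2) /
    (Real.pi / (4 * w.1)) ^ ((N : ℝ) / 2)) * Real.exp (-(2 * w.1) * ‖w.2‖ ^ 2))

@[fun_prop]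
theorem measurable_coulombRoot : Measurable (coulombRoot (N := N)) := by
  unfold coulombRoot
  fun_prop

/-- Integrating in `z` leaves `t ^ (a - 1) exp (-t ‖x - y‖²) / Γ(a)` with `a = (N - 2) / 2`; the
Gamma integral in `t` then yields `‖x - y‖ ^ (-2 a)`. -/
theorem lintegral_coulombRoot_mul (hN : 3 ≤ N) {x y : Space N} (hxy : x ≠ y) :
    ∫⁻ t in Set.Ioi (0 : ℝ), ∫⁻ z : Space N, coulombRoot (t, z - x) * coulombRoot (t, z - y) =
      ENNReal.ofReal (1 / ‖x - y‖ ^ (N - 2)) := by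
  set a : ℝ := ((N : ℝ) - 2) / 2 with ha
  have hN' : (3 : ℝ) ≤ N := by exact_mod_cast hN
  have ha0 : 0 < a := by rw [ha]; linarith
  have hr : 0 < ‖x - y‖ ^ 2 := by
    have := norm_pos_iff.2 (sub_ne_zero.2 hxy)
    positivity
  have hG := Real.Gamma_pos_of_pos ha0
  have inner : ∀ t ∈ Set.Ioi (0 : ℝ),
      ∫⁻ z : Space N, coulombRoot (t, z - x) * coulombRoot (t, z - y) =
        ENNReal.ofReal (t ^ (a - 1) * Real.exp (-(‖x - y‖ ^ 2 * t)) / Real.Gamma a) := by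
    intro t ht
    have ht : 0 < t := ht
    have hW : 0 ≤ t ^ (a - 1) / Real.Gamma a / (Real.pi / (4 * t)) ^ ((N : ℝ) / 2) := by positivity
    -- Completing the square at the midpoint of `x` and `y`, by the parallelogram law.
    have hpt : ∀ z : Space N, coulombRoot (t, z - x) * coulombRoot (t, z - y) =
        ENNReal.ofReal (t ^ (a - 1) / Real.Gamma a / (Real.pi / (4 * t)) ^ ((N : ℝ) / 2) *
          Real.exp (-(‖x - y‖ ^ 2 * t))) *
          ENNReal.ofReal (Real.exp (-(4 * t) * ‖z - (2⁻¹ : ℝ) • (x + y)‖ ^ 2)) := by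
      intro z
      simp only [coulombRoot]
      rw [← ENNReal.ofReal_mul (by positivity), ← ENNReal.ofReal_mul (by positivity)]
      congr 1
      rw [mul_mul_mul_comm, Real.mul_self_sqrt hW, mul_assoc, ← Real.exp_add, ← Real.exp_add]
      congr 2
      have h1 : z - x = (z - (2⁻¹ : ℝ) • (x + y)) - (2⁻¹ : ℝ) • (x - y) := by
        module
      have h2 : z - y = (z - (2⁻¹ : ℝ) • (x + y)) + (2⁻¹ : ℝ) • (x - y) := by
        module
      have h3 := parallelogram_law_with_norm ℝ (z - (2⁻¹ : ℝ) • (x + y)) ((2⁻¹ : ℝ) • (x - y))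
      rw [← h1, ← h2, norm_smul, Real.norm_of_nonneg (by norm_num : (0 : ℝ) ≤ 2⁻¹)] at h3
      linear_combination (-(2 * t)) * h3
    simp_rw [hpt]
    rw [lintegral_const_mul _ (by fun_prop),
      lintegral_sub_right_eq_self
        (fun z : Space N => ENNReal.ofReal (Real.exp (-(4 * t) * ‖z‖ ^ 2))),
      ← ofReal_integral_eq_lintegral_ofReal ?_ (Eventually.of_forall fun _ => (Real.exp_pos _).le),
      GaussianFourier.integral_rexp_neg_mul_sq_norm (by positivity), finrank_euclideanSpace_fin,
      ← ENNReal.ofReal_mul (by positivity)]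
    · congr 1
      have : (Real.pi / (4 * t)) ^ ((N : ℝ) / 2) ≠ 0 := by positivity
      field_simp
    · have := GaussianFourier.integral_rexp_neg_mul_sq_norm (V := Space N)
        (b := 4 * t) (by positivity)
      -- A nonintegrable function has Bochner integral `0`, whereas the Gaussian integral is
      -- positive.
      by_contra hi
      rw [integral_undef hi] at this
      have : (0 : ℝ) < (Real.pi / (4 * t)) ^ ((Module.finrank ℝ (Space N)) / 2 : ℝ) := by positivity
      linarith
  rw [setLIntegral_congr_fun measurableSet_Ioi inner]
  have hint := Real.integral_rpow_mul_exp_neg_mul_Ioi ha0 hr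
  rw [← ofReal_integral_eq_lintegral_ofReal, integral_div, hint]
  · congr 1
    rw [mul_div_assoc, div_self hG.ne', mul_one, ← Real.rpow_natCast ‖x - y‖ 2,
      Real.div_rpow zero_le_one (by positivity), Real.one_rpow, ← Real.rpow_mul (norm_nonneg _),
      ← Real.rpow_natCast]
    congr 2
    rw [ha]
    push_cast [show 2 ≤ N by omega]
    ring
  · by_contra hi
    have hi' : ¬ Integrable (fun t : ℝ => t ^ (a - 1) * Real.exp (-(‖x - y‖ ^ 2 * t)))
        (volume.restrict (Set.Ioi 0)) := fun h => hi (h.div_const _)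
    rw [integral_undef hi'] at hint
    have : 0 < (1 / ‖x - y‖ ^ 2) ^ a * Real.Gamma a := by positivity
    linarith
  · filter_upwards [ae_restrict_mem measurableSet_Ioi] with t ht
    have ht : 0 < t := ht
    positivity

/-- The parameter space over which the autocorrelations of `coulombRoot` are integrated. -/
noncomputable def coulombMeasure (N : ℕ) : Measure (ℝ × Space N) :=
  (volume.restrict (Set.Ioi 0)).prod volume

instance : SFinite (coulombMeasure N) := by
  unfold coulombMeasure
  infer_instance

/-- The average of `u²` against a weighted Gaussian. -/
noncomputable def gaussAverage (u : Space N → ℝ) (w : ℝ × Space N) : ℝ≥0∞ :=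
  ∫⁻ x, coulombRoot (w.1, w.2 - x) * ‖u x‖ₑ ^ 2

theorem measurable_gaussAverage {u : Space N → ℝ} (hu : Measurable u) :
    Measurable (gaussAverage u) := by
  unfold gaussAverage
  refine Measurable.lintegral_prod_right'
    (f := fun p : (ℝ × Space N) × Space N => coulombRoot (p.1.1, p.1.2 - p.2) * ‖u p.2‖ₑ ^ 2) ?_
  fun_prop

theorem coulombIntegrand_eq (u : Space N → ℝ) (x y : Space N) :
    ENNReal.ofReal (u x ^ 2 * u y ^ 2 / ‖x - y‖ ^ (N - 2)) =
      ‖u x‖ₑ ^ 2 * ‖u y‖ₑ ^ 2 * ENNReal.ofReal (1 / ‖x - y‖ ^ (N - 2)) := by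
  rw [div_eq_mul_one_div, ENNReal.ofReal_mul (by positivity), ENNReal.ofReal_mul (by positivity)]
  rw [← sq_abs (u x), ← sq_abs (u y), ENNReal.ofReal_pow (abs_nonneg _),
    ENNReal.ofReal_pow (abs_nonneg _)]
  simp only [← ofReal_norm, Real.norm_eq_abs]

theorem coulombEnergy_congr {u v : Space N → ℝ} (h : u =ᵐ[volume] v) :
    coulombEnergy u = coulombEnergy v := by
  refine lintegral_congr_ae ?_
  filter_upwards [h] with x hx
  refine lintegral_congr_ae ?_
  filter_upwards [h] with y hy
  rw [hx, hy]

theorem coulombEnergy_mono {u v : Space N → ℝ} (h : ∀ᵐ x, ‖u x‖ ≤ ‖v x‖) :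
    coulombEnergy u ≤ coulombEnergy v := by
  refine lintegral_mono_ae ?_
  filter_upwards [h] with x hx
  refine lintegral_mono_ae ?_
  filter_upwards [h] with y hy
  rw [← sq_abs (u x), ← sq_abs (u y), ← sq_abs (v x), ← sq_abs (v y)]
  simp only [Real.norm_eq_abs] at hx hy
  gcongr

theorem coulombEnergy_const_smul (c : ℝ) (u : Space N → ℝ) :
    coulombEnergy (fun x => c * u x) = ENNReal.ofReal (c ^ 4) * coulombEnergy u := by
  unfold coulombEnergy
  rw [← lintegral_const_mul' _ _ ENNReal.ofReal_ne_top]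
  refine lintegral_congr fun x => ?_
  rw [← lintegral_const_mul' _ _ ENNReal.ofReal_ne_top]
  refine lintegral_congr fun y => ?_
  rw [← ENNReal.ofReal_mul (by positivity)]
  congr 1
  ring

theorem coulombEnergy_eq_lintegral_gaussAverage (hN : 3 ≤ N) {u : Space N → ℝ}
    (hu : Measurable u) :
    coulombEnergy u = ∫⁻ w, gaussAverage u w ^ 2 ∂coulombMeasure N := by
  have : Nontrivial (Space N) := by
    have : Nonempty (Fin N) := ⟨⟨0, by omega⟩⟩
    infer_instance
  have h1 : ∀ w : ℝ × Space N, gaussAverage u w ^ 2 = ∫⁻ x, ∫⁻ y,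
      ‖u x‖ₑ ^ 2 * ‖u y‖ₑ ^ 2 * (coulombRoot (w.1, w.2 - x) * coulombRoot (w.1, w.2 - y)) := by
    intro w
    rw [sq, gaussAverage, ← lintegral_lintegral_mul (by fun_prop) (by fun_prop)]
    refine lintegral_congr fun x => lintegral_congr fun y => ?_
    ring
  simp_rw [h1]
  rw [lintegral_lintegral_swap]
  · refine lintegral_congr fun x => ?_
    rw [lintegral_lintegral_swap (by fun_prop)]
    refine lintegral_congr_ae ?_
    -- The diagonal must be discarded: there the kernel takes the value `1 / 0 = 0`, and the
    -- factorisation is stated only for `x ≠ y`.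
    filter_upwards [measure_eq_zero_iff_ae_notMem.1 (measure_singleton (μ := volume) x)] with y hy
    rw [coulombIntegrand_eq, lintegral_const_mul _ (by fun_prop),
      ← lintegral_coulombRoot_mul hN (fun h => hy (by simp [h])), coulombMeasure,
      lintegral_prod _ (by fun_prop)]
  · refine (Measurable.lintegral_prod_right' (f := fun p : ((ℝ × Space N) × Space N) × Space N =>
      ‖u p.1.2‖ₑ ^ 2 * ‖u p.2‖ₑ ^ 2 * (coulombRoot (p.1.1.1, p.1.1.2 - p.1.2) *
        coulombRoot (p.1.1.1, p.1.1.2 - p.2))) ?_).aemeasurable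
    fun_prop

/-! ### Clarkson and triangle inequalities for the Coulomb norm -/

theorem enorm_add_sq_add_enorm_sub_sq {F : Type*} [NormedAddCommGroup F] [InnerProductSpace ℝ F]
    (a b : F) : ‖a + b‖ₑ ^ 2 + ‖a - b‖ₑ ^ 2 = 2 * ‖a‖ₑ ^ 2 + 2 * ‖b‖ₑ ^ 2 := by
  simp only [← ofReal_norm, ← ENNReal.ofReal_pow (norm_nonneg _)]
  rw [← ENNReal.ofReal_ofNat 2, ← ENNReal.ofReal_mul (by norm_num),
    ← ENNReal.ofReal_mul (by norm_num), ← ENNReal.ofReal_add (by positivity) (by positivity),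
    ← ENNReal.ofReal_add (by positivity) (by positivity)]
  congr 1
  have := parallelogram_law_with_norm ℝ a b
  linarith

theorem gaussAverage_add_add_sub {u v : Space N → ℝ} (hu : Measurable u) (hv : Measurable v)
    (w : ℝ × Space N) :
    gaussAverage (u + v) w + gaussAverage (u - v) w =
      2 * gaussAverage u w + 2 * gaussAverage v w := by
  unfold gaussAverage
  rw [← lintegral_add_left (by fun_prop), ← lintegral_const_mul _ (by fun_prop),
    ← lintegral_const_mul _ (by fun_prop), ← lintegral_add_left (by fun_prop)]
  refine lintegral_congr fun x => ?_
  rw [← mul_add, Pi.add_apply, Pi.sub_apply, enorm_add_sq_add_enorm_sub_sq]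
  ring

theorem ENNReal.add_sq_le_two_mul (a b : ℝ≥0∞) : (a + b) ^ 2 ≤ 2 * (a ^ 2 + b ^ 2) := by
  rcases eq_or_ne a ⊤ with rfl | ha
  · simp
  rcases eq_or_ne b ⊤ with rfl | hb
  · simp
  lift a to NNReal using ha
  lift b to NNReal using hb
  norm_cast
  exact add_sq_le

/-- Clarkson's inequality for the Coulomb norm. -/
theorem coulombEnergy_add_add_sub_le (hN : 3 ≤ N) {u v : Space N → ℝ} (hu : Measurable u)
    (hv : Measurable v) :
    coulombEnergy (u + v) + coulombEnergy (u - v) ≤ 8 * (coulombEnergy u + coulombEnergy v) := by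
  have mu := measurable_gaussAverage hu
  have mv := measurable_gaussAverage hv
  have ma := measurable_gaussAverage (hu.add hv)
  rw [coulombEnergy_eq_lintegral_gaussAverage hN hu, coulombEnergy_eq_lintegral_gaussAverage hN hv,
    coulombEnergy_eq_lintegral_gaussAverage hN (hu.add hv),
    coulombEnergy_eq_lintegral_gaussAverage hN (hu.sub hv),
    ← lintegral_add_left (by fun_prop), ← lintegral_add_left (by fun_prop),
    ← lintegral_const_mul _ (by fun_prop)]
  refine lintegral_mono fun w => ?_
  -- Clarkson already holds for each `w`: the averages are nonnegative, so the sum of their squares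
  -- is at most the square of their sum, which the parallelogram identity evaluates.
  calc gaussAverage (u + v) w ^ 2 + gaussAverage (u - v) w ^ 2
      ≤ (gaussAverage (u + v) w + gaussAverage (u - v) w) ^ 2 := by
        rw [add_sq]; gcongr; exact le_self_add
    _ = 4 * (gaussAverage u w + gaussAverage v w) ^ 2 := by
        rw [gaussAverage_add_add_sub hu hv]; ring
    _ ≤ 4 * (2 * (gaussAverage u w ^ 2 + gaussAverage v w ^ 2)) := by
        gcongr; exact ENNReal.add_sq_le_two_mul _ _
    _ = _ := by ring

theorem gaussAverage_rpow_half {u : Space N → ℝ} (hu : Measurable u) (w : ℝ × Space N) :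
    gaussAverage u w ^ (1 / 2 : ℝ) =
      eLpNorm u 2 (volume.withDensity fun x => coulombRoot (w.1, w.2 - x)) := by
  rw [eLpNorm_eq_lintegral_rpow_enorm_toReal (by norm_num) (by norm_num),
    lintegral_withDensity_eq_lintegral_mul _ (by fun_prop) (by fun_prop)]
  simp [gaussAverage]

/-- The triangle inequality for the Coulomb norm. -/
theorem coulombEnergy_add_rpow_le (hN : 3 ≤ N) {u v : Space N → ℝ} (hu : Measurable u)
    (hv : Measurable v) :
    coulombEnergy (u + v) ^ (1 / 4 : ℝ) ≤
      coulombEnergy u ^ (1 / 4 : ℝ) + coulombEnergy v ^ (1 / 4 : ℝ) := by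
  -- The Coulomb norm is the `L⁴` norm in `w` of the `L²` norm of `f` for the weight `coulombRoot
  -- (w.1, w.2 - x)`; Minkowski applies to both.
  have key : ∀ {f : Space N → ℝ}, Measurable f →
      coulombEnergy f = ∫⁻ w, (gaussAverage f w ^ (1 / 2 : ℝ)) ^ (4 : ℝ) ∂coulombMeasure N := by
    intro f hf
    rw [coulombEnergy_eq_lintegral_gaussAverage hN hf]
    refine lintegral_congr fun w => ?_
    rw [← ENNReal.rpow_mul, ← ENNReal.rpow_natCast]
    norm_num
  have mu := measurable_gaussAverage hu
  have mv := measurable_gaussAverage hv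
  rw [key hu, key hv, key (hu.add hv)]
  refine le_trans ?_ (ENNReal.lintegral_Lp_add_le (by fun_prop) (by fun_prop) (by norm_num))
  gcongr with w
  rw [Pi.add_apply, gaussAverage_rpow_half hu, gaussAverage_rpow_half hv,
    gaussAverage_rpow_half (hu.add hv)]
  exact eLpNorm_add_le hu.aestronglyMeasurable hv.aestronglyMeasurable (by norm_num)

/-! ### Convergence, finiteness and averaging of the Coulomb energy -/

/-- Fatou's lemma for the Coulomb energy. -/
theorem coulombEnergy_le_liminf {v : ℕ → Space N → ℝ} {u : Space N → ℝ}
    (hv : ∀ n, Measurable (v n)) (h : ∀ᵐ x, Tendsto (fun n => v n x) atTop (nhds (u x))) :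
    coulombEnergy u ≤ liminf (fun n => coulombEnergy (v n)) atTop := by
  have hm : ∀ n, Measurable fun p : Space N × Space N =>
      ENNReal.ofReal (v n p.1 ^ 2 * v n p.2 ^ 2 / ‖p.1 - p.2‖ ^ (N - 2)) := by
    intro n
    have := hv n
    fun_prop
  refine le_trans (lintegral_mono_ae ?_)
    (lintegral_liminf_le fun n => (hm n).lintegral_prod_right)
  filter_upwards [h] with x hx
  refine le_trans (lintegral_mono_ae ?_)
    (lintegral_liminf_le fun n => (hm n).comp measurable_prodMk_left)
  filter_upwards [h] with y hy
  refine le_of_eq (Tendsto.liminf_eq ?_).symm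
  refine ENNReal.tendsto_ofReal ?_
  exact ((hx.pow 2).mul (hy.pow 2)).div_const _

/-- Abstract step from pointwise to norm convergence: `c` is the energy of a difference, `s` that of
a sum. A Clarkson or parallelogram inequality gives the first hypothesis, Fatou the second; `s` is
then squeezed to `K`, leaving nothing for `c`. -/
theorem tendsto_zero_of_add_le_of_le_liminf {c s : ℕ → ℝ≥0∞} {K : ℝ≥0∞} (hK : K ≠ ⊤)
    (h : ∀ n, c n + s n ≤ K) (hs : K ≤ liminf s atTop) : Tendsto c atTop (nhds 0) := by
  have h1 : Tendsto s atTop (nhds K) := by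
    refine tendsto_of_le_liminf_of_limsup_le hs ?_
    exact limsup_le_of_le (by isBoundedDefault) (Eventually.of_forall fun n => le_add_self.trans (h n))
  have h2 : Tendsto (fun n => K - s n) atTop (nhds (K - K)) :=
    ENNReal.Tendsto.sub tendsto_const_nhds h1 (Or.inl hK)
  rw [tsub_self] at h2
  refine tendsto_of_tendsto_of_tendsto_of_le_of_le tendsto_const_nhds h2 (fun n => zero_le) ?_
  intro n
  exact ENNReal.le_sub_of_add_le_right (ne_top_of_le_ne_top hK (le_add_self.trans (h n))) (h n)

/-- Clarkson bounds the energies of `v n + u` and `v n - u` together by `16 D(u)`, which is the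
energy of `2 u`, the pointwise limit of `v n + u`. -/
theorem tendsto_coulombEnergy_sub (hN : 3 ≤ N) {v : ℕ → Space N → ℝ} {u : Space N → ℝ}
    (hv : ∀ n, Measurable (v n)) (hu : Measurable u) (hfin : coulombEnergy u ≠ ⊤)
    (hle : ∀ n, coulombEnergy (v n) ≤ coulombEnergy u)
    (h : ∀ᵐ x, Tendsto (fun n => v n x) atTop (nhds (u x))) :
    Tendsto (fun n => coulombEnergy (v n - u)) atTop (nhds 0) := by
  refine tendsto_zero_of_add_le_of_le_liminf (s := fun n => coulombEnergy (v n + u))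
    (K := 16 * coulombEnergy u) (ENNReal.mul_ne_top (by norm_num) hfin) (fun n => ?_) ?_
  · rw [add_comm]
    refine (coulombEnergy_add_add_sub_le hN (hv n) hu).trans ?_
    calc 8 * (coulombEnergy (v n) + coulombEnergy u)
        ≤ 8 * (coulombEnergy u + coulombEnergy u) := by gcongr; exact hle n
      _ = _ := by ring
  · have h2 : 16 * coulombEnergy u = coulombEnergy (fun x => 2 * u x) := by
      rw [coulombEnergy_const_smul]
      norm_num
    rw [h2]
    refine coulombEnergy_le_liminf (fun n => (hv n).add hu) ?_
    filter_upwards [h] with x hx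
    rw [two_mul]
    exact hx.add_const _

theorem lintegral_ball_one_div_norm_pow_lt_top (hN : 3 ≤ N) (R : ℝ) :
    ∫⁻ z : Space N in Metric.ball 0 R, ENNReal.ofReal (1 / ‖z‖ ^ (N - 2)) < ⊤ := by
  have hint : IntegrableOn (fun z : Space N => 1 / ‖z‖ ^ (N - 2)) (Metric.ball 0 R) := by
    refine integrableOn_ball_of_norm_le_rpow (C := 1) (α := ((N - 2 : ℕ) : ℝ)) ?_ ?_
      (Eventually.of_forall fun z => ?_)
      (Measurable.aestronglyMeasurable (by fun_prop))
    · rw [finrank_euclideanSpace_fin]; omega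
    · rw [finrank_euclideanSpace_fin]
      exact_mod_cast (by omega : N - 2 < N)
    · rw [Real.norm_of_nonneg (by positivity), Real.rpow_neg (norm_nonneg _), Real.rpow_natCast,
        one_mul, one_div]
  exact hint.lintegral_lt_top

theorem coulombEnergy_lt_top_of_bounded (hN : 3 ≤ N) {u : Space N → ℝ} {M R : ℝ}
    (hM : ∀ x, ‖u x‖ ≤ M) (hR : ∀ x, R < ‖x‖ → u x = 0) : coulombEnergy u < ⊤ := by
  -- Two points of the support are at distance at most `2 R`; the extra `1` allows an open ball.
  set g : Space N → ℝ≥0∞ := (Metric.ball 0 (2 * R + 1)).indicator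
    fun z => ENNReal.ofReal (1 / ‖z‖ ^ (N - 2)) with hg
  have hgm : Measurable g := by
    refine Measurable.indicator ?_ measurableSet_ball
    fun_prop
  have hle : ∀ x y : Space N, ENNReal.ofReal (u x ^ 2 * u y ^ 2 / ‖x - y‖ ^ (N - 2)) ≤
      (Metric.closedBall (0 : Space N) R).indicator (fun _ => ENNReal.ofReal (M ^ 4)) x *
        g (x - y) := by
    intro x y
    rcases lt_or_ge R ‖x‖ with hx | hx
    · simp [hR x hx]
    rcases lt_or_ge R ‖y‖ with hy | hy
    · simp [hR y hy]
    have hxy : x - y ∈ Metric.ball (0 : Space N) (2 * R + 1) := by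
      rw [mem_ball_zero_iff]
      linarith [norm_sub_le x y]
    rw [hg, Set.indicator_of_mem hxy, Set.indicator_of_mem (by simpa using hx),
      ← ENNReal.ofReal_mul (by positivity), div_eq_mul_one_div]
    refine ENNReal.ofReal_le_ofReal ?_
    have h1 : u x ^ 2 ≤ M ^ 2 := by
      rw [← sq_abs]; gcongr; exact hM x
    have h2 : u y ^ 2 ≤ M ^ 2 := by
      rw [← sq_abs]; gcongr; exact hM y
    rw [show M ^ 4 = M ^ 2 * M ^ 2 by ring]
    gcongr
  calc coulombEnergy u
      ≤ ∫⁻ x : Space N, ∫⁻ y : Space N,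
          (Metric.closedBall (0 : Space N) R).indicator (fun _ => ENNReal.ofReal (M ^ 4)) x *
            g (x - y) := lintegral_mono fun x => lintegral_mono fun y => hle x y
    _ = ∫⁻ x : Space N, (Metric.closedBall (0 : Space N) R).indicator
          (fun _ => ENNReal.ofReal (M ^ 4)) x * ∫⁻ y, g y := by
        refine lintegral_congr fun x => ?_
        rw [lintegral_const_mul _ (by fun_prop), lintegral_sub_left_eq_self]
    _ = ENNReal.ofReal (M ^ 4) * volume (Metric.closedBall (0 : Space N) R) * ∫⁻ y, g y := by
        rw [lintegral_mul_const _ (measurable_const.indicator measurableSet_closedBall),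
          lintegral_indicator_const measurableSet_closedBall]
    _ < ⊤ := by
        refine ENNReal.mul_lt_top (ENNReal.mul_lt_top ENNReal.ofReal_lt_top
          measure_closedBall_lt_top) ?_
        rw [hg, lintegral_indicator measurableSet_ball]
        exact lintegral_ball_one_div_norm_pow_lt_top hN _

/-- Jensen's inequality, as monotonicity of `L^p` norms in the exponent on a probability space. -/
theorem rpow_lintegral_le_lintegral_rpow {α : Type*} [MeasurableSpace α] {ν : Measure α}
    [IsProbabilityMeasure ν] {f : α → ℝ≥0∞} (hf : AEMeasurable f ν) {p : ℝ} (hp : 1 ≤ p) :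
    (∫⁻ x, f x ∂ν) ^ p ≤ ∫⁻ x, f x ^ p ∂ν := by
  have h := eLpNorm'_le_eLpNorm'_of_exponent_le zero_lt_one hp ν hf.aestronglyMeasurable
  simp only [eLpNorm', enorm_eq_self, ENNReal.rpow_one, div_one] at h
  rw [one_div, ENNReal.le_rpow_inv_iff (by linarith)] at h
  exact h

/-- Averaging over translations does not increase the Coulomb energy. -/
theorem coulombEnergy_le_of_average (hN : 3 ≤ N) {ν : Measure (Space N)} [IsProbabilityMeasure ν]
    {u v : Space N → ℝ} (hu : Measurable u) (hv : Measurable v)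
    (h : ∀ x, ‖v x‖ₑ ^ 2 ≤ ∫⁻ y, ‖u (x - y)‖ₑ ^ 2 ∂ν) : coulombEnergy v ≤ coulombEnergy u := by
  have mu := measurable_gaussAverage hu
  have mv := measurable_gaussAverage hv
  -- Translating `u` translates its Gaussian average in `z`. After Jensen, each translate has the
  -- same integral in `z`, and `ν` has mass one.
  have h1 : ∀ t z, gaussAverage v (t, z) ≤ ∫⁻ y, gaussAverage u (t, z - y) ∂ν := by
    intro t z
    calc gaussAverage v (t, z)
        ≤ ∫⁻ x, ∫⁻ y, coulombRoot (t, z - x) * ‖u (x - y)‖ₑ ^ 2 ∂ν := by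
          refine lintegral_mono fun x => ?_
          rw [lintegral_const_mul _ (by fun_prop)]
          gcongr
          exact h x
      _ = ∫⁻ y, (∫⁻ x, coulombRoot (t, z - x) * ‖u (x - y)‖ₑ ^ 2) ∂ν :=
          lintegral_lintegral_swap (by fun_prop)
      _ = ∫⁻ y, gaussAverage u (t, z - y) ∂ν := by
          refine lintegral_congr fun y => ?_
          simpa [gaussAverage] using lintegral_sub_right_eq_self
            (fun x => coulombRoot (t, z - y - x) * ‖u x‖ₑ ^ 2) y
  rw [coulombEnergy_eq_lintegral_gaussAverage hN hu, coulombEnergy_eq_lintegral_gaussAverage hN hv,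
    coulombMeasure, lintegral_prod _ (by fun_prop),
    lintegral_prod _ (by fun_prop)]
  refine lintegral_mono fun t => ?_
  calc ∫⁻ z, gaussAverage v (t, z) ^ 2
      ≤ ∫⁻ z, ∫⁻ y, gaussAverage u (t, z - y) ^ 2 ∂ν := by
        refine lintegral_mono fun z => ?_
        refine (pow_le_pow_left₀ zero_le (h1 t z) 2).trans ?_
        have := rpow_lintegral_le_lintegral_rpow (ν := ν)
          (f := fun y => gaussAverage u (t, z - y)) (by fun_prop) one_le_two
        simpa using this
    _ = ∫⁻ y, (∫⁻ z, gaussAverage u (t, z - y) ^ 2) ∂ν := lintegral_lintegral_swap (by fun_prop)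
    _ = ∫⁻ y, (∫⁻ z, gaussAverage u (t, z) ^ 2) ∂ν := by
        refine lintegral_congr fun y => ?_
        rw [lintegral_sub_right_eq_self (fun z => gaussAverage u (t, z) ^ 2)]
    _ = ∫⁻ z, gaussAverage u (t, z) ^ 2 := by simp

/-! ### Radial cutoffs and mollifiers -/

/-- A smooth radial function with values in `[0, 1]`, equal to `1` on the unit ball and
supported in the ball of radius `2`. -/
noncomputable def plateau (x : Space N) : ℝ := Real.smoothTransition (2 - ‖x‖ ^ 2)

theorem contDiff_plateau : ContDiff ℝ ∞ (plateau (N := N)) :=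
  Real.smoothTransition.contDiff.comp (contDiff_const.sub (contDiff_norm_sq ℝ))

theorem plateau_nonneg (x : Space N) : 0 ≤ plateau x := Real.smoothTransition.nonneg _

theorem plateau_le_one (x : Space N) : plateau x ≤ 1 := Real.smoothTransition.le_one _

theorem plateau_eq_one {x : Space N} (hx : ‖x‖ ≤ 1) : plateau x = 1 :=
  Real.smoothTransition.one_of_one_le (by nlinarith [norm_nonneg x])

theorem plateau_eq_zero {x : Space N} (hx : 2 ≤ ‖x‖) : plateau x = 0 :=
  Real.smoothTransition.zero_of_nonpos (by nlinarith)

theorem plateau_congr {x y : Space N} (h : ‖x‖ = ‖y‖) : plateau x = plateau y := by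
  rw [plateau, plateau, h]

theorem hasCompactSupport_plateau : HasCompactSupport (plateau (N := N)) :=
  HasCompactSupport.intro (isCompact_closedBall 0 2) fun x hx =>
    plateau_eq_zero (by simpa using (not_le.1 (by simpa using hx)).le)

/-- Rescaled plateaus are test functions. -/
theorem isTestFunction_plateau_smul {c : ℝ} (hc : c ≠ 0) :
    IsTestFunction fun x : Space N => plateau (c • x) :=
  ⟨contDiff_plateau.comp (contDiff_const_smul c), hasCompactSupport_plateau.comp_smul hc⟩

/-- The cutoff functions, equal to `1` on the ball of radius `n + 1`. -/
noncomputable def cutoff (n : ℕ) (x : Space N) : ℝ := plateau (((n : ℝ) + 1)⁻¹ • x)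

/-- Radial mollifiers, supported in the ball of radius `2 / (n + 1)`. -/
noncomputable def mollifier (n : ℕ) (x : Space N) : ℝ :=
  (∫ y : Space N, plateau (((n : ℝ) + 1) • y))⁻¹ * plateau (((n : ℝ) + 1) • x)

theorem isTestFunction_cutoff (n : ℕ) : IsTestFunction (cutoff (N := N) n) :=
  isTestFunction_plateau_smul (by positivity)

theorem isTestFunction_mollifier (n : ℕ) : IsTestFunction (mollifier (N := N) n) :=
  have h := isTestFunction_plateau_smul (N := N) (c := (n : ℝ) + 1) (by positivity)
  ⟨contDiff_const.mul h.1, h.2.mul_left⟩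

theorem integrable_plateau_smul (n : ℕ) :
    Integrable fun y : Space N => plateau (((n : ℝ) + 1) • y) :=
  have h := isTestFunction_plateau_smul (N := N) (c := (n : ℝ) + 1) (by positivity)
  h.1.continuous.integrable_of_hasCompactSupport h.2

theorem measureReal_closedBall_le_integral_plateau (n : ℕ) :
    volume.real (Metric.closedBall (0 : Space N) ((n : ℝ) + 1)⁻¹) ≤
      ∫ y : Space N, plateau (((n : ℝ) + 1) • y) := by
  have hn : (0 : ℝ) < (n : ℝ) + 1 := by positivity
  rw [← integral_indicator_one measurableSet_closedBall]
  refine integral_mono ?_ (integrable_plateau_smul n) fun y => ?_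
  · exact (integrable_indicator_iff measurableSet_closedBall).2
      (integrableOn_const measure_closedBall_lt_top.ne)
  · by_cases hy : y ∈ Metric.closedBall (0 : Space N) ((n : ℝ) + 1)⁻¹
    · rw [Set.indicator_of_mem hy, plateau_eq_one]
      · rfl
      · rw [norm_smul, Real.norm_of_nonneg hn.le]
        have : ‖y‖ ≤ ((n : ℝ) + 1)⁻¹ := by simpa using hy
        calc ((n : ℝ) + 1) * ‖y‖ ≤ ((n : ℝ) + 1) * ((n : ℝ) + 1)⁻¹ := by gcongr
          _ = 1 := mul_inv_cancel₀ hn.ne'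
    · rw [Set.indicator_of_notMem hy]
      exact plateau_nonneg _

theorem integral_plateau_pos (n : ℕ) : 0 < ∫ y : Space N, plateau (((n : ℝ) + 1) • y) := by
  refine lt_of_lt_of_le ?_ (measureReal_closedBall_le_integral_plateau n)
  exact ENNReal.toReal_pos (Metric.measure_closedBall_pos _ _ (by positivity)).ne'
    measure_closedBall_lt_top.ne

theorem mollifier_nonneg (n : ℕ) (x : Space N) : 0 ≤ mollifier n x :=
  mul_nonneg (inv_nonneg.2 (integral_plateau_pos n).le) (plateau_nonneg _)

theorem mollifier_congr (n : ℕ) {x y : Space N} (h : ‖x‖ = ‖y‖) :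
    mollifier n x = mollifier n y := by
  rw [mollifier, mollifier, plateau_congr]
  rw [norm_smul, norm_smul, h]

theorem cutoff_congr (n : ℕ) {x y : Space N} (h : ‖x‖ = ‖y‖) : cutoff n x = cutoff n y := by
  rw [cutoff, cutoff, plateau_congr]
  rw [norm_smul, norm_smul, h]

theorem integral_mollifier (n : ℕ) : ∫ x : Space N, mollifier n x = 1 := by
  simp only [mollifier]
  rw [integral_const_mul, inv_mul_cancel₀ (integral_plateau_pos n).ne']

theorem integrable_mollifier (n : ℕ) : Integrable (mollifier (N := N) n) :=
  (integrable_plateau_smul n).const_mul _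

theorem mollifier_eq_zero (n : ℕ) {x : Space N} (h : 2 / ((n : ℝ) + 1) ≤ ‖x‖) :
    mollifier n x = 0 := by
  rw [mollifier, plateau_eq_zero, mul_zero]
  rw [norm_smul, Real.norm_of_nonneg (by positivity)]
  rwa [div_le_iff₀' (by positivity)] at h

/-- The plateau equals `1` on a ball of half the support radius, so the normalising integral is at
least `2 ^ (-N)` times the volume of the larger ball. The bound, uniform after scaling, is what
differentiation at Lebesgue points requires. -/
theorem mollifier_le (n : ℕ) (x : Space N) :
    mollifier n x ≤ 2 ^ N / volume.real (Metric.closedBall (0 : Space N) (2 / ((n : ℝ) + 1))) := by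
  have h1 : volume.real (Metric.closedBall (0 : Space N) (2 / ((n : ℝ) + 1))) =
      2 ^ N * volume.real (Metric.closedBall (0 : Space N) ((n : ℝ) + 1)⁻¹) := by
    rw [div_eq_mul_inv, Measure.real, Measure.addHaar_closedBall_mul _ _ (by norm_num)
      (by positivity), ENNReal.toReal_mul, ENNReal.toReal_ofReal (by positivity),
      finrank_euclideanSpace_fin, Measure.real]
  have h2 : 0 < volume.real (Metric.closedBall (0 : Space N) ((n : ℝ) + 1)⁻¹) :=
    ENNReal.toReal_pos (Metric.measure_closedBall_pos _ _ (by positivity)).ne'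
      measure_closedBall_lt_top.ne
  rw [h1, div_mul_eq_div_div, div_self (by positivity), one_div, mollifier]
  calc _ ≤ (∫ y : Space N, plateau (((n : ℝ) + 1) • y))⁻¹ * 1 := by
        gcongr
        · exact inv_nonneg.2 (integral_plateau_pos n).le
        · exact plateau_le_one _
    _ ≤ _ := by
        rw [mul_one]
        gcongr
        exact measureReal_closedBall_le_integral_plateau n

/-! ### Test functions and their gradients -/

theorem IsTestFunction.isWeakGradient {φ : Space N → ℝ} (hφ : IsTestFunction φ)
    {g : Space N → Space N} (hg : ∀ x v, fderiv ℝ φ x v = inner ℝ (g x) v)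
    (hgc : Continuous g) : IsWeakGradient φ g := by
  refine ⟨hφ.1.continuous.locallyIntegrable, hgc.locallyIntegrable, fun ψ hψ v => ?_⟩
  have h1 : Continuous fun x => fderiv ℝ φ x v :=
    (hφ.1.continuous_fderiv (by simp)).clm_apply continuous_const
  have h2 : Continuous fun x => fderiv ℝ ψ x v :=
    (hψ.1.continuous_fderiv (by simp)).clm_apply continuous_const
  simp_rw [← hg]
  refine integral_mul_fderiv_eq_neg_fderiv_mul_of_integrable ?_ ?_ ?_
    (fun x _ => hφ.1.differentiable (by simp) x) (fun x _ => hψ.1.differentiable (by simp) x)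
  · exact (h1.mul hψ.1.continuous).integrable_of_hasCompactSupport hψ.2.mul_left
  · exact (hφ.1.continuous.mul h2).integrable_of_hasCompactSupport hφ.2.mul_right
  · exact (hφ.1.continuous.mul hψ.1.continuous).integrable_of_hasCompactSupport hψ.2.mul_left

theorem fderiv_apply_eq_inner_gradient (φ : Space N → ℝ) (x v : Space N) :
    fderiv ℝ φ x v = inner ℝ (gradient φ x) v := by
  simp [gradient]

theorem norm_gradient (φ : Space N → ℝ) (x : Space N) : ‖gradient φ x‖ = ‖fderiv ℝ φ x‖ :=
  LinearIsometryEquiv.norm_map _ _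

theorem IsTestFunction.continuous_gradient {φ : Space N → ℝ} (hφ : IsTestFunction φ) :
    Continuous (gradient φ) :=
  (LinearIsometryEquiv.continuous _).comp (hφ.1.continuous_fderiv (by simp))

theorem IsTestFunction.isWeakGradient_gradient {φ : Space N → ℝ} (hφ : IsTestFunction φ) :
    IsWeakGradient φ (gradient φ) :=
  hφ.isWeakGradient (fderiv_apply_eq_inner_gradient φ) hφ.continuous_gradient

theorem IsTestFunction.hasCompactSupport_gradient {φ : Space N → ℝ} (hφ : IsTestFunction φ) :
    HasCompactSupport (gradient φ) := by
  refine (hφ.2.fderiv (𝕜 := ℝ)).comp_left (g := (InnerProductSpace.toDual ℝ (Space N)).symm) ?_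
  simp

theorem IsTestFunction.memLp {φ : Space N → ℝ} (hφ : IsTestFunction φ) (p : ℝ≥0∞) :
    MemLp φ p :=
  hφ.1.continuous.memLp_of_hasCompactSupport hφ.2

theorem IsTestFunction.memLp_gradient {φ : Space N → ℝ} (hφ : IsTestFunction φ) (p : ℝ≥0∞) :
    MemLp (gradient φ) p :=
  hφ.continuous_gradient.memLp_of_hasCompactSupport hφ.hasCompactSupport_gradient

theorem IsTestFunction.coulombEnergy_lt_top (hN : 3 ≤ N) {φ : Space N → ℝ}
    (hφ : IsTestFunction φ) : coulombEnergy φ < ⊤ := by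
  obtain ⟨M, hM⟩ := hφ.1.continuous.bounded_above_of_compact_support hφ.2
  obtain ⟨R, hR⟩ := hφ.2.isCompact.isBounded.subset_closedBall 0
  refine coulombEnergy_lt_top_of_bounded hN hM (R := R) fun x hx => ?_
  by_contra h
  have := hR (subset_tsupport φ h)
  rw [mem_closedBall_zero_iff] at this
  linarith

/-! ### Mollification -/

section Mollify

variable {F : Type*} [NormedAddCommGroup F] [NormedSpace ℝ F]

/-- The convolution of `u` with the mollifier. -/
noncomputable def mollify (n : ℕ) (u : Space N → F) (x : Space N) : F :=
  ∫ y, mollifier n (x - y) • u y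

theorem mollify_eq (n : ℕ) (u : Space N → F) (x : Space N) :
    mollify n u x = ∫ y, mollifier n y • u (x - y) := by
  rw [mollify, ← integral_sub_left_eq_self _ volume x]
  simp

theorem contDiff_mollify (n : ℕ) {u : Space N → F} (hu : LocallyIntegrable u) :
    ContDiff ℝ ∞ (mollify n u) :=
  HasCompactSupport.contDiff_convolution_right (ContinuousLinearMap.lsmul ℝ ℝ).flip (n := ⊤)
    (isTestFunction_mollifier n).2 hu (isTestFunction_mollifier n).1

theorem mollify_congr_ae (n : ℕ) {u v : Space N → F} (h : u =ᵐ[volume] v) :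
    mollify n u = mollify n v := by
  funext x
  refine integral_congr_ae ?_
  filter_upwards [h] with y hy
  rw [hy]

/-- Convergence holds at every Lebesgue point: the mollifiers have integral one, shrinking supports,
and densities comparable to those of uniform averages over balls. -/
theorem ae_tendsto_mollify {u : Space N → F} [CompleteSpace F] (hu : LocallyIntegrable u) :
    ∀ᵐ x, Tendsto (fun n => mollify n u x) atTop (nhds (u x)) := by
  filter_upwards [(Besicovitch.vitaliFamily volume).ae_tendsto_average_norm_sub hu] with x h₀
  have hr : Tendsto (fun n : ℕ => 2 / ((n : ℝ) + 1)) atTop (nhdsWithin 0 (Set.Ioi 0)) :=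
    tendsto_nhdsWithin_iff.2 ⟨by
      simpa [div_eq_mul_inv] using
        (tendsto_one_div_add_atTop_nhds_zero_nat (𝕜 := ℝ)).const_mul 2,
      Eventually.of_forall fun n => by simp only [Set.mem_Ioi]; positivity⟩
  have := (h₀.comp (Besicovitch.tendsto_filterAt volume x)).comp hr
  refine tendsto_integral_smul_of_tendsto_average_norm_sub (2 ^ N) this ?_ ?_ ?_ ?_
  · exact Eventually.of_forall fun n => hu.integrableOn_isCompact (isCompact_closedBall _ _)
  · refine tendsto_const_nhds.congr fun n => ?_
    rw [integral_sub_left_eq_self (mollifier n) volume x, integral_mollifier]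
  · refine Eventually.of_forall fun n y hy => ?_
    by_contra h
    refine hy (mollifier_eq_zero n ?_)
    rw [Metric.mem_closedBall, dist_comm, dist_eq_norm, not_le] at h
    exact h.le
  · refine Eventually.of_forall fun n y => ?_
    rw [abs_of_nonneg (mollifier_nonneg _ _), Measure.real,
      Measure.addHaar_closedBall_center volume x]
    exact mollifier_le n _

/-- The probability measure whose density is the mollifier. -/
noncomputable def mollifierMeasure (N n : ℕ) : Measure (Space N) :=
  volume.withDensity fun y => ENNReal.ofReal (mollifier n y)

instance (n : ℕ) : IsProbabilityMeasure (mollifierMeasure N n) := by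
  refine ⟨?_⟩
  rw [mollifierMeasure, withDensity_apply _ MeasurableSet.univ, Measure.restrict_univ,
    ← ofReal_integral_eq_lintegral_ofReal (integrable_mollifier n)
      (Eventually.of_forall (mollifier_nonneg n)), integral_mollifier, ENNReal.ofReal_one]

theorem measurable_mollifier (n : ℕ) : Measurable (mollifier (N := N) n) :=
  (isTestFunction_mollifier n).1.continuous.measurable

theorem ae_norm_le_two_mollifierMeasure (n : ℕ) : ∀ᵐ y ∂mollifierMeasure N n, ‖y‖ ≤ 2 := by
  have hm := measurable_mollifier (N := N) n
  rw [mollifierMeasure, ae_withDensity_iff (by fun_prop)]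
  refine Eventually.of_forall fun y hy => ?_
  by_contra h
  rw [not_le] at h
  refine hy ?_
  rw [mollifier_eq_zero n, ENNReal.ofReal_zero]
  refine le_trans (div_le_self (by norm_num) ?_) h.le
  linarith [n.cast_nonneg (α := ℝ)]

theorem enorm_mollify_le (n : ℕ) {u : Space N → F} (hu : StronglyMeasurable u) (x : Space N) :
    ‖mollify n u x‖ₑ ≤ ∫⁻ y, ‖u (x - y)‖ₑ ∂mollifierMeasure N n := by
  have hm := measurable_mollifier (N := N) n
  have hu' : Measurable fun y => ‖u (x - y)‖ₑ := by
    have := hu.enorm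
    fun_prop
  rw [mollifierMeasure, lintegral_withDensity_eq_lintegral_mul _ (by fun_prop) hu', mollify_eq]
  refine (enorm_integral_le_lintegral_enorm _).trans (le_of_eq ?_)
  refine lintegral_congr fun y => ?_
  rw [enorm_smul, Pi.mul_apply, Real.enorm_of_nonneg (mollifier_nonneg n y)]

theorem enorm_mollify_rpow_le (n : ℕ) {u : Space N → F} (hu : StronglyMeasurable u) (x : Space N)
    {p : ℝ} (hp : 1 ≤ p) :
    ‖mollify n u x‖ₑ ^ p ≤ ∫⁻ y, ‖u (x - y)‖ₑ ^ p ∂mollifierMeasure N n := by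
  have := hu.enorm
  refine (ENNReal.rpow_le_rpow (enorm_mollify_le n hu x) (by linarith)).trans ?_
  exact rpow_lintegral_le_lintegral_rpow (Measurable.aemeasurable (by fun_prop)) hp

/-- Mollification does not increase `L^p` norms, up to an enlargement of the domain. -/
theorem setLIntegral_mollify_rpow_le (n : ℕ) {u : Space N → F} (hu : StronglyMeasurable u)
    {p : ℝ} (hp : 1 ≤ p) {s t : Set (Space N)} (hs : MeasurableSet s) (ht : MeasurableSet t)
    (hst : ∀ x ∈ s, ∀ y : Space N, ‖y‖ ≤ 2 → x - y ∈ t) :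
    ∫⁻ x in s, ‖mollify n u x‖ₑ ^ p ≤ ∫⁻ x in t, ‖u x‖ₑ ^ p := by
  have := hu.enorm
  calc ∫⁻ x in s, ‖mollify n u x‖ₑ ^ p
      ≤ ∫⁻ x in s, ∫⁻ y, ‖u (x - y)‖ₑ ^ p ∂mollifierMeasure N n :=
        lintegral_mono fun x => enorm_mollify_rpow_le n hu x hp
    _ = ∫⁻ y, (∫⁻ x in s, ‖u (x - y)‖ₑ ^ p) ∂mollifierMeasure N n :=
        lintegral_lintegral_swap (Measurable.aemeasurable (by fun_prop))
    _ ≤ ∫⁻ y, (∫⁻ x in t, ‖u x‖ₑ ^ p) ∂mollifierMeasure N n := by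
        -- For a fixed shift `y` of norm at most 2, translation carries the integral over `s` into
        -- one over `t`.
        refine lintegral_mono_ae ?_
        filter_upwards [ae_norm_le_two_mollifierMeasure n] with y hy
        rw [← lintegral_indicator hs, ← lintegral_indicator ht,
          ← lintegral_sub_right_eq_self (t.indicator fun x => ‖u x‖ₑ ^ p) y]
        refine lintegral_mono fun x => ?_
        by_cases hx : x ∈ s
        · rw [Set.indicator_of_mem hx, Set.indicator_of_mem (hst x hx y hy)]
        · rw [Set.indicator_of_notMem hx]
          exact zero_le
    _ = ∫⁻ x in t, ‖u x‖ₑ ^ p := by simp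

theorem lintegral_mollify_rpow_le (n : ℕ) {u : Space N → F} (hu : StronglyMeasurable u)
    {p : ℝ} (hp : 1 ≤ p) : ∫⁻ x, ‖mollify n u x‖ₑ ^ p ≤ ∫⁻ x, ‖u x‖ₑ ^ p := by
  simpa using setLIntegral_mollify_rpow_le n hu hp MeasurableSet.univ MeasurableSet.univ (by simp)

end Mollify

/-- The derivative of a mollification is the mollification of the weak gradient. -/
theorem IsWeakGradient.fderiv_mollify {u : Space N → ℝ} {g : Space N → Space N}
    (h : IsWeakGradient u g) (n : ℕ) (x v : Space N) :
    fderiv ℝ (mollify n u) x v = inner ℝ (mollify n g x) v := by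
  have hρ := isTestFunction_mollifier (N := N) n
  have hd := (hρ.2.hasFDerivAt_convolution_right (ContinuousLinearMap.lsmul ℝ ℝ).flip
    h.locallyIntegrable (hρ.1.of_le (by simp)) x).fderiv
  have hd' : fderiv ℝ (mollify n u) x = _ := hd
  rw [hd', convolution_precompR_apply _ h.locallyIntegrable (hρ.2.fderiv (𝕜 := ℝ))
    (hρ.1.continuous_fderiv (by simp)), convolution_def]
  -- The reflected, translated mollifier is itself a test function; pairing it with the weak
  -- gradient gives the formula, the reflection cancelling the minus sign.
  have htest : IsTestFunction fun y => mollifier n (x - y) :=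
    ⟨hρ.1.comp (contDiff_const.sub contDiff_id), hρ.2.comp_homeomorph (Homeomorph.subLeft x)⟩
  have hw := h.integral_eq _ htest v
  have hf : ∀ y, fderiv ℝ (fun y => mollifier n (x - y)) y v =
      -fderiv ℝ (mollifier n) (x - y) v := by
    intro y
    have := ((hρ.1.differentiable (by simp) (x - y)).hasFDerivAt.comp y
      ((hasFDerivAt_const x y).sub (hasFDerivAt_id y))).fderiv
    simp only [Function.comp_def] at this
    rw [this]
    simp
  simp only [hf, mul_neg, integral_neg, neg_inj] at hw
  have hi : Integrable fun y => mollifier n (x - y) • g y :=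
    h.locallyIntegrable_grad.integrable_smul_left_of_hasCompactSupport htest.1.continuous htest.2
  rw [mollify, real_inner_comm, ← integral_inner hi]
  simp only [ContinuousLinearMap.flip_apply, ContinuousLinearMap.lsmul_apply, smul_eq_mul,
    inner_smul_right]
  refine (integral_congr_ae (Eventually.of_forall fun y => mul_comm _ _)).trans
    (hw.trans (integral_congr_ae (Eventually.of_forall fun y => ?_)))
  simp only
  rw [mul_comm, real_inner_comm]

/-! ### Approximation by mollifying and cutting off -/

theorem cutoff_nonneg (n : ℕ) (x : Space N) : 0 ≤ cutoff n x := plateau_nonneg _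

theorem cutoff_le_one (n : ℕ) (x : Space N) : cutoff n x ≤ 1 := plateau_le_one _

theorem norm_inv_add_one_smul (n : ℕ) (x : Space N) :
    ‖((n : ℝ) + 1)⁻¹ • x‖ = ‖x‖ / ((n : ℝ) + 1) := by
  rw [norm_smul, norm_inv, Real.norm_of_nonneg (by positivity), div_eq_inv_mul]

theorem eventually_cutoff_eq_one (x : Space N) : ∀ᶠ n : ℕ in atTop, cutoff n x = 1 := by
  obtain ⟨m, hm⟩ := exists_nat_ge ‖x‖
  filter_upwards [eventually_ge_atTop m] with n hn
  refine plateau_eq_one ?_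
  rw [norm_inv_add_one_smul, div_le_one (by positivity)]
  have : (m : ℝ) ≤ n := by exact_mod_cast hn
  linarith

/-- The annulus on which the cutoff function is not locally constant. -/
def annulus (N n : ℕ) : Set (Space N) := {x | (n : ℝ) + 1 ≤ ‖x‖ ∧ ‖x‖ ≤ 2 * ((n : ℝ) + 1)}

theorem measurableSet_annulus (n : ℕ) : MeasurableSet (annulus N n) :=
  ((isClosed_le continuous_const continuous_norm).inter
    (isClosed_le continuous_norm continuous_const)).measurableSet

theorem fderiv_plateau_eq_zero {x : Space N} (hx : ‖x‖ < 1 ∨ 2 < ‖x‖) :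
    fderiv ℝ plateau x = 0 := by
  rcases hx with hx | hx
  · have : plateau =ᶠ[nhds x] fun _ => (1 : ℝ) := by
      filter_upwards [(isOpen_lt continuous_norm continuous_const).mem_nhds hx] with y hy
      exact plateau_eq_one (le_of_lt hy)
    rw [this.fderiv_eq, fderiv_const_apply]
  · have : plateau =ᶠ[nhds x] fun _ => (0 : ℝ) := by
      filter_upwards [(isOpen_lt continuous_const continuous_norm).mem_nhds hx] with y hy
      exact plateau_eq_zero (le_of_lt hy)
    rw [this.fderiv_eq, fderiv_const_apply]

theorem exists_norm_gradient_cutoff_le : ∃ C : ℝ, 0 ≤ C ∧ ∀ (n : ℕ) (x : Space N),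
    ‖gradient (cutoff n) x‖ ≤ (annulus N n).indicator (fun _ => C / ((n : ℝ) + 1)) x := by
  obtain ⟨C, hC⟩ := (contDiff_plateau (N := N).continuous_fderiv (by simp)).bounded_above_of_compact_support
    (hasCompactSupport_plateau.fderiv (𝕜 := ℝ))
  refine ⟨C, (norm_nonneg _).trans (hC 0), fun n x => ?_⟩
  have h : fderiv ℝ (cutoff n) x =
      ((n : ℝ) + 1)⁻¹ • fderiv ℝ plateau (((n : ℝ) + 1)⁻¹ • x) :=
    fderiv_comp_smul _
  rw [norm_gradient, h, norm_smul, norm_inv, Real.norm_of_nonneg (by positivity)]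
  by_cases hx : x ∈ annulus N n
  · rw [Set.indicator_of_mem hx, div_eq_inv_mul]
    gcongr
    exact hC _
  · rw [Set.indicator_of_notMem hx, fderiv_plateau_eq_zero, norm_zero, mul_zero]
    rw [norm_inv_add_one_smul, div_lt_one (by positivity), lt_div_iff₀ (by positivity)]
    by_contra! h
    exact hx h

/-- Approximation by test functions: mollify, then cut off. -/
noncomputable def approx (n : ℕ) (u : Space N → ℝ) (x : Space N) : ℝ :=
  cutoff n x * mollify n u x

theorem isTestFunction_approx (n : ℕ) {u : Space N → ℝ} (hu : LocallyIntegrable u) :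
    IsTestFunction (approx n u) :=
  ⟨(isTestFunction_cutoff n).1.mul (contDiff_mollify n hu), (isTestFunction_cutoff n).2.mul_right⟩

theorem IsWeakGradient.gradient_approx {u : Space N → ℝ} {g : Space N → Space N}
    (h : IsWeakGradient u g) (n : ℕ) (x : Space N) :
    gradient (approx n u) x =
      cutoff n x • mollify n g x + mollify n u x • gradient (cutoff n) x := by
  refine ext_inner_right ℝ fun v => ?_
  have h1 := (isTestFunction_cutoff (N := N) n).1.differentiable (by simp) x
  have h2 := (contDiff_mollify n h.locallyIntegrable).differentiable (by simp) x
  have h3 : fderiv ℝ (approx n u) x = _ := fderiv_mul h1 h2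
  rw [← fderiv_apply_eq_inner_gradient, h3, inner_add_left, inner_smul_left, inner_smul_left,
    ← h.fderiv_mollify, ← fderiv_apply_eq_inner_gradient]
  simp

theorem ae_tendsto_approx {u : Space N → ℝ} (hu : LocallyIntegrable u) :
    ∀ᵐ x, Tendsto (fun n => approx n u x) atTop (nhds (u x)) := by
  filter_upwards [ae_tendsto_mollify hu] with x hx
  refine hx.congr' ?_
  filter_upwards [eventually_cutoff_eq_one x] with n hn
  rw [approx, hn, one_mul]

theorem tendsto_coulombEnergy_approx_sub (hN : 3 ≤ N) {u : Space N → ℝ} (hu : Measurable u)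
    (hloc : LocallyIntegrable u) (hfin : coulombEnergy u ≠ ⊤) :
    Tendsto (fun n => coulombEnergy (approx n u - u)) atTop (nhds 0) := by
  refine tendsto_coulombEnergy_sub hN
    (fun n => (isTestFunction_approx n hloc).1.continuous.measurable) hu hfin (fun n => ?_)
    (ae_tendsto_approx hloc)
  calc coulombEnergy (approx n u) ≤ coulombEnergy (mollify n u) := by
        refine coulombEnergy_mono (Eventually.of_forall fun x => ?_)
        rw [approx, norm_mul, Real.norm_of_nonneg (cutoff_nonneg n x)]
        exact mul_le_of_le_one_left (norm_nonneg _) (cutoff_le_one n x)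
    _ ≤ coulombEnergy u := by
        refine coulombEnergy_le_of_average hN (ν := mollifierMeasure N n) hu
          (contDiff_mollify n hloc).continuous.measurable fun x => ?_
        simpa using enorm_mollify_rpow_le n hu.stronglyMeasurable x one_le_two

/-- The `L²` counterpart of `tendsto_coulombEnergy_sub`, with the parallelogram law in place of
Clarkson; `4` is the factor between the squares of `2 g` and `g`. -/
theorem tendsto_lintegral_sub_sq {α F : Type*} [MeasurableSpace α] {μ : Measure α}
    [NormedAddCommGroup F] [InnerProductSpace ℝ F] {v : ℕ → α → F} {g : α → F}
    (hv : ∀ n, StronglyMeasurable (v n)) (hg : StronglyMeasurable g)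
    (hfin : ∫⁻ x, ‖g x‖ₑ ^ 2 ∂μ ≠ ⊤)
    (hle : ∀ n, ∫⁻ x, ‖v n x‖ₑ ^ 2 ∂μ ≤ ∫⁻ x, ‖g x‖ₑ ^ 2 ∂μ)
    (h : ∀ᵐ x ∂μ, Tendsto (fun n => v n x) atTop (nhds (g x))) :
    Tendsto (fun n => ∫⁻ x, ‖v n x - g x‖ₑ ^ 2 ∂μ) atTop (nhds 0) := by
  refine tendsto_zero_of_add_le_of_le_liminf (s := fun n => ∫⁻ x, ‖v n x + g x‖ₑ ^ 2 ∂μ)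
    (K := 4 * ∫⁻ x, ‖g x‖ₑ ^ 2 ∂μ) (ENNReal.mul_ne_top (by norm_num) hfin) (fun n => ?_) ?_
  · have h1 := (hv n).enorm
    have h2 := hg.enorm
    have h3 := ((hv n).add hg).enorm
    rw [add_comm, ← lintegral_add_left (by exact h3.pow_const 2)]
    simp_rw [enorm_add_sq_add_enorm_sub_sq]
    rw [lintegral_add_left (by fun_prop), lintegral_const_mul _ (by fun_prop),
      lintegral_const_mul _ (by fun_prop)]
    calc 2 * ∫⁻ x, ‖v n x‖ₑ ^ 2 ∂μ + 2 * ∫⁻ x, ‖g x‖ₑ ^ 2 ∂μ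
        ≤ 2 * ∫⁻ x, ‖g x‖ₑ ^ 2 ∂μ + 2 * ∫⁻ x, ‖g x‖ₑ ^ 2 ∂μ := by
          gcongr 2 * ?_ + _
          exact hle n
      _ = _ := by ring
  · have h3 := fun n => ((hv n).add hg).enorm
    rw [← lintegral_const_mul _ (hg.enorm.pow_const 2)]
    refine le_trans (lintegral_mono_ae ?_) (lintegral_liminf_le fun n => (h3 n).pow_const 2)
    filter_upwards [h] with x hx
    refine le_of_eq ?_
    have h4 : Tendsto (fun n => ‖v n x + g x‖ₑ ^ 2) atTop (nhds (‖g x + g x‖ₑ ^ 2)) :=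
      ENNReal.Tendsto.pow (hx.add_const (g x)).enorm
    rw [Tendsto.liminf_eq h4, ← two_smul ℝ (g x), enorm_smul, mul_pow]
    norm_num [Real.enorm_eq_ofReal]

theorem eLpNorm_two_eq {α F : Type*} [MeasurableSpace α] {μ : Measure α}
    [NormedAddCommGroup F] (f : α → F) :
    eLpNorm f 2 μ = (∫⁻ x, ‖f x‖ₑ ^ 2 ∂μ) ^ (1 / 2 : ℝ) := by
  rw [eLpNorm_eq_lintegral_rpow_enorm_toReal (by norm_num) (by norm_num)]
  simp

theorem MeasureTheory.MemLp.lintegral_enorm_sq_ne_top {α F : Type*} [MeasurableSpace α] {μ : Measure α}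
    [NormedAddCommGroup F] {f : α → F} (hf : MemLp f 2 μ) : ∫⁻ x, ‖f x‖ₑ ^ 2 ∂μ ≠ ⊤ := by
  have := hf.2
  rw [eLpNorm_two_eq, ENNReal.rpow_lt_top_iff_of_pos (by norm_num)] at this
  exact this.ne

theorem tendsto_eLpNorm_cutoff_smul_mollify_sub {g : Space N → Space N}
    (hg : StronglyMeasurable g) (hloc : LocallyIntegrable g) (hg2 : MemLp g 2) :
    Tendsto (fun n => eLpNorm (fun x => cutoff n x • mollify n g x - g x) 2 volume)
      atTop (nhds 0) := by
  simp_rw [eLpNorm_two_eq]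
  have key : Tendsto (fun n => ∫⁻ x, ‖cutoff n x • mollify n g x - g x‖ₑ ^ 2) atTop (nhds 0) := by
    refine tendsto_lintegral_sub_sq (fun n => ?_) hg hg2.lintegral_enorm_sq_ne_top
      (fun n => ?_) ?_
    · exact ((isTestFunction_cutoff n).1.continuous.smul
        (contDiff_mollify n hloc).continuous).stronglyMeasurable
    · calc ∫⁻ x, ‖cutoff n x • mollify n g x‖ₑ ^ 2 ≤ ∫⁻ x, ‖mollify n g x‖ₑ ^ 2 := by
            gcongr with x
            rw [enorm_smul]
            refine mul_le_of_le_one_left zero_le ?_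
            rw [Real.enorm_of_nonneg (cutoff_nonneg n x), ← ENNReal.ofReal_one]
            exact ENNReal.ofReal_le_ofReal (cutoff_le_one n x)
        _ ≤ ∫⁻ x, ‖g x‖ₑ ^ 2 := by simpa using lintegral_mollify_rpow_le n hg one_le_two
    · filter_upwards [ae_tendsto_mollify hloc] with x hx
      refine hx.congr' ?_
      filter_upwards [eventually_cutoff_eq_one x] with n hn
      rw [hn, one_smul]
  simpa using key.ennrpow_const (1 / 2)

/-- The radius `n - 1` is the inner radius `n + 1` of the annulus less the enlargement `2` caused by
mollification. -/
theorem tendsto_setLIntegral_norm_ge {f : Space N → ℝ≥0∞} (hf : Measurable f)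
    (hfin : ∫⁻ x, f x ≠ ⊤) :
    Tendsto (fun n : ℕ => ∫⁻ x in {x | (n : ℝ) - 1 ≤ ‖x‖}, f x) atTop (nhds 0) := by
  have hm : ∀ n : ℕ, MeasurableSet {x : Space N | (n : ℝ) - 1 ≤ ‖x‖} := fun n =>
    (isClosed_le continuous_const continuous_norm).measurableSet
  simp_rw [← lintegral_indicator (hm _)]
  rw [← lintegral_zero (μ := (volume : Measure (Space N)))]
  refine tendsto_lintegral_of_dominated_convergence f (fun n => hf.indicator (hm n))
    (fun n => Eventually.of_forall fun x => Set.indicator_le_self _ _ x) hfin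
    (Eventually.of_forall fun x => ?_)
  obtain ⟨m, hm⟩ := exists_nat_gt (‖x‖ + 1)
  refine tendsto_const_nhds.congr' ?_
  filter_upwards [eventually_ge_atTop m] with n hn
  rw [Set.indicator_of_notMem]
  have : (m : ℝ) ≤ n := by exact_mod_cast hn
  simp only [Set.mem_ofPred_eq, not_le]
  linarith

/-! ### Convergence of gradients and the Sobolev exponent -/

/-- The Sobolev exponent of `ℝ^N`. -/
noncomputable def sobolevExponent (N : ℕ) : ℝ≥0∞ := ENNReal.ofReal (2 * (N : ℝ) / ((N : ℝ) - 2))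

theorem two_le_sobolev (hN : 3 ≤ N) : 2 ≤ 2 * (N : ℝ) / ((N : ℝ) - 2) := by
  have hN' : (3 : ℝ) ≤ N := by exact_mod_cast hN
  rw [le_div_iff₀ (by linarith)]
  linarith

theorem sobolevExponent_toReal (hN : 3 ≤ N) :
    (sobolevExponent N).toReal = 2 * (N : ℝ) / ((N : ℝ) - 2) :=
  ENNReal.toReal_ofReal (zero_le_two.trans (two_le_sobolev hN))

theorem two_le_sobolevExponent (hN : 3 ≤ N) : 2 ≤ sobolevExponent N := by
  rw [sobolevExponent, ← ENNReal.ofReal_ofNat]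
  exact ENNReal.ofReal_le_ofReal (two_le_sobolev hN)

theorem eLpNorm_sobolevExponent {F : Type*} [NormedAddCommGroup F] (hN : 3 ≤ N)
    (f : Space N → F) (μ : Measure (Space N)) :
    eLpNorm f (sobolevExponent N) μ =
      (∫⁻ x, ‖f x‖ₑ ^ (2 * (N : ℝ) / ((N : ℝ) - 2)) ∂μ) ^ (1 / (2 * (N : ℝ) / ((N : ℝ) - 2))) := by
  rw [eLpNorm_eq_lintegral_rpow_enorm_toReal (zero_lt_two.trans_le (two_le_sobolevExponent hN)).ne'
    ENNReal.ofReal_ne_top, sobolevExponent_toReal hN]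

theorem volume_annulus_rpow_le (hN : 3 ≤ N) (n : ℕ) :
    volume (annulus N n) ^ (1 / (N : ℝ)) ≤
      ENNReal.ofReal (2 * ((n : ℝ) + 1)) * volume (Metric.closedBall (0 : Space N) 1) ^ (1 / (N : ℝ)) := by
  have hsub : annulus N n ⊆ Metric.closedBall (0 : Space N) (2 * ((n : ℝ) + 1) * 1) := by
    intro x hx
    simpa using hx.2
  calc volume (annulus N n) ^ (1 / (N : ℝ))
      ≤ volume (Metric.closedBall (0 : Space N) (2 * ((n : ℝ) + 1) * 1)) ^ (1 / (N : ℝ)) := by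
        gcongr
    _ = _ := by
        rw [Measure.addHaar_closedBall_mul _ _ (by positivity) zero_le_one,
          finrank_euclideanSpace_fin, ENNReal.mul_rpow_of_nonneg _ _ (by positivity),
          ENNReal.ofReal_pow (by positivity), ← ENNReal.rpow_natCast, ← ENNReal.rpow_mul,
          mul_one_div_cancel (by positivity), ENNReal.rpow_one]

/-- The cutoff gradient is of size `C / (n + 1)` on an annulus whose volume to the power `1 / N` is
of order `n + 1`. These scales cancel in Hölder's inequality, leaving a constant times a tail of the
`L^p` norm of `u`. -/
theorem tendsto_eLpNorm_mollify_smul_gradient_cutoff (hN : 3 ≤ N) {u : Space N → ℝ}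
    (hu : Measurable u) (hloc : LocallyIntegrable u) (hup : MemLp u (sobolevExponent N)) :
    Tendsto (fun n => eLpNorm (fun x => mollify n u x • gradient (cutoff n) x) 2 volume)
      atTop (nhds 0) := by
  obtain ⟨C, hC0, hC⟩ := exists_norm_gradient_cutoff_le (N := N)
  have hN' : (3 : ℝ) ≤ N := by exact_mod_cast hN
  set p : ℝ := 2 * (N : ℝ) / ((N : ℝ) - 2) with hp
  have hp2 : 2 ≤ p := two_le_sobolev hN
  set V : ℝ≥0∞ := volume (Metric.closedBall (0 : Space N) 1) ^ (1 / (N : ℝ)) with hV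
  have hVfin : V ≠ ⊤ := ENNReal.rpow_ne_top_of_nonneg (by positivity) measure_closedBall_lt_top.ne
  have hbound : ∀ n : ℕ, eLpNorm (fun x => mollify n u x • gradient (cutoff n) x) 2 volume ≤
      ENNReal.ofReal (2 * C) * V * (∫⁻ x in {x | (n : ℝ) - 1 ≤ ‖x‖}, ‖u x‖ₑ ^ p) ^ (1 / p) := by
    intro n
    have hmeas := (contDiff_mollify n hloc).continuous.aestronglyMeasurable
      (μ := volume.restrict (annulus N n))
    calc eLpNorm (fun x => mollify n u x • gradient (cutoff n) x) 2 volume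
        ≤ eLpNorm ((annulus N n).indicator ((C / ((n : ℝ) + 1)) • mollify n u)) 2 volume := by
          refine eLpNorm_mono fun x => ?_
          rw [norm_smul]
          refine (mul_le_mul_of_nonneg_left (hC n x) (norm_nonneg _)).trans (le_of_eq ?_)
          by_cases hx : x ∈ annulus N n
          · rw [Set.indicator_of_mem hx, Set.indicator_of_mem hx, Pi.smul_apply, norm_smul,
              Real.norm_of_nonneg (by positivity : 0 ≤ C / ((n : ℝ) + 1)), mul_comm]
          · rw [Set.indicator_of_notMem hx, Set.indicator_of_notMem hx]; simp
      _ = ENNReal.ofReal (C / ((n : ℝ) + 1)) *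
            eLpNorm (mollify n u) 2 (volume.restrict (annulus N n)) := by
          rw [eLpNorm_indicator_eq_eLpNorm_restrict (measurableSet_annulus n), eLpNorm_const_smul,
            Real.enorm_of_nonneg (by positivity)]
      _ ≤ ENNReal.ofReal (C / ((n : ℝ) + 1)) *
            (eLpNorm (mollify n u) (sobolevExponent N) (volume.restrict (annulus N n)) *
              (ENNReal.ofReal (2 * ((n : ℝ) + 1)) * V)) := by
          gcongr
          refine (eLpNorm_le_eLpNorm_mul_rpow_measure_univ (two_le_sobolevExponent hN)
            hmeas).trans ?_
          gcongr
          rw [sobolevExponent_toReal hN, Measure.restrict_apply_univ]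
          -- The Sobolev relation: exactly this exponent makes the estimate scale invariant.
          have hexp : 1 / (2 : ℝ≥0∞).toReal - 1 / (2 * (N : ℝ) / ((N : ℝ) - 2)) = 1 / N := by
            rw [ENNReal.toReal_ofNat]
            have : (N : ℝ) - 2 ≠ 0 := by linarith
            field_simp
            ring
          rw [hexp]
          exact volume_annulus_rpow_le hN n
      _ = ENNReal.ofReal (2 * C) * V *
            eLpNorm (mollify n u) (sobolevExponent N) (volume.restrict (annulus N n)) := by
          have : ENNReal.ofReal (2 * C) =
              ENNReal.ofReal (C / ((n : ℝ) + 1)) * ENNReal.ofReal (2 * ((n : ℝ) + 1)) := by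
            rw [← ENNReal.ofReal_mul (by positivity)]
            congr 1
            field_simp
          rw [this]
          ring
      _ ≤ _ := by
          rw [eLpNorm_sobolevExponent hN]
          refine mul_le_mul' le_rfl (ENNReal.rpow_le_rpow ?_ (by positivity))
          refine setLIntegral_mollify_rpow_le n hu.stronglyMeasurable (by linarith)
            (measurableSet_annulus n)
            (isClosed_le continuous_const continuous_norm).measurableSet fun x hx y hy => ?_
          have := norm_sub_norm_le x y
          have := hx.1
          simp only [Set.mem_ofPred_eq]
          linarith
  have hfin : ∫⁻ x, ‖u x‖ₑ ^ p ≠ ⊤ := by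
    have := hup.2
    rw [eLpNorm_sobolevExponent hN, ENNReal.rpow_lt_top_iff_of_pos (by positivity)] at this
    exact this.ne
  have htail := (tendsto_setLIntegral_norm_ge (hu.enorm.pow_const p) hfin).ennrpow_const (1 / p)
  rw [ENNReal.zero_rpow_of_pos (by positivity)] at htail
  have := ENNReal.Tendsto.const_mul (a := ENNReal.ofReal (2 * C) * V) htail
    (Or.inr (ENNReal.mul_ne_top ENNReal.ofReal_ne_top hVfin))
  rw [mul_zero] at this
  exact tendsto_of_tendsto_of_tendsto_of_le_of_le tendsto_const_nhds this (fun _ => zero_le) hbound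

/-- The gradients of the approximations converge in `L²`. -/
theorem IsWeakGradient.tendsto_eLpNorm_gradient_approx_sub (hN : 3 ≤ N) {u : Space N → ℝ}
    {g : Space N → Space N} (h : IsWeakGradient u g) (hu : Measurable u)
    (hg : StronglyMeasurable g) (hup : MemLp u (sobolevExponent N)) (hg2 : MemLp g 2) :
    Tendsto (fun n => eLpNorm (gradient (approx n u) - g) 2 volume) atTop (nhds 0) := by
  have h1 := (tendsto_eLpNorm_cutoff_smul_mollify_sub hg h.locallyIntegrable_grad hg2).add
    (tendsto_eLpNorm_mollify_smul_gradient_cutoff hN hu h.locallyIntegrable hup)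
  rw [add_zero] at h1
  refine tendsto_of_tendsto_of_tendsto_of_le_of_le tendsto_const_nhds h1 (fun _ => zero_le)
    fun n => ?_
  have h2 : gradient (approx n u) - g = (fun x => cutoff n x • mollify n g x - g x) +
      fun x => mollify n u x • gradient (cutoff n) x := by
    funext x
    rw [Pi.sub_apply, h.gradient_approx, Pi.add_apply]
    abel
  rw [h2]
  have hc := isTestFunction_cutoff (N := N) n
  refine eLpNorm_add_le ?_ ?_ (by norm_num)
  · exact ((hc.1.continuous.smul (contDiff_mollify n h.locallyIntegrable_grad).continuous
      ).stronglyMeasurable.sub hg).aestronglyMeasurable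
  · exact ((contDiff_mollify n h.locallyIntegrable).continuous.smul
      hc.continuous_gradient).aestronglyMeasurable

/-! ### Radial symmetry of the approximations -/

theorem isRadial_of_congr {f : Space N → ℝ} (h : ∀ x y, ‖x‖ = ‖y‖ → f x = f y) : IsRadial f := by
  classical
  refine ⟨fun r => if hr : ∃ x : Space N, ‖x‖ = r then f hr.choose else 0, fun x => ?_⟩
  have hr : ∃ y : Space N, ‖y‖ = ‖x‖ := ⟨x, rfl⟩
  simp only [dif_pos hr]
  exact h _ _ hr.choose_spec.symm

/-- Points of equal norm are exchanged by the reflection in the hyperplane orthogonal to `x - y`, a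
measure-preserving isometry that leaves `f` and the mollifier invariant. -/
theorem IsRadial.mollify {f : Space N → ℝ} (hf : IsRadial f) (n : ℕ) {x y : Space N}
    (hxy : ‖x‖ = ‖y‖) : mollify n f x = mollify n f y := by
  obtain ⟨h, hh⟩ := hf
  set A : Space N ≃ₗᵢ[ℝ] Space N := (Submodule.span ℝ {x - y})ᗮ.reflection with hA
  have hAx : A x = y := Submodule.reflection_sub hxy
  have hp := A.measurePreserving
  have := hp.integral_comp A.toHomeomorph.measurableEmbedding
    (fun z => mollifier n (y - z) • f z)
  rw [_root_.mollify, _root_.mollify, ← this]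
  refine integral_congr_ae (Eventually.of_forall fun z => ?_)
  simp only
  rw [← hAx, ← map_sub, mollifier_congr n (A.norm_map (x - z)), hh z, hh (A z), A.norm_map]

theorem isRadial_approx {u f : Space N → ℝ} (h : u =ᵐ[volume] f) (hf : IsRadial f) (n : ℕ) :
    IsRadial (approx n u) := by
  refine isRadial_of_congr fun x y hxy => ?_
  rw [approx, approx, mollify_congr_ae n h, cutoff_congr n hxy, hf.mollify n hxy]

/-! ### The Sobolev inequality -/

/-- The Sobolev inequality for test functions. -/
theorem exists_eLpNorm_le_gradient_of_isTestFunction (hN : 3 ≤ N) :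
    ∃ S : NNReal, ∀ φ : Space N → ℝ, IsTestFunction φ →
      eLpNorm φ (sobolevExponent N) ≤ S * eLpNorm (gradient φ) 2 := by
  have hN' : (3 : ℝ) ≤ N := by exact_mod_cast hN
  refine ⟨SNormLESNormFDerivOfEqConst ℝ (volume : Measure (Space N)) (2 : NNReal), fun φ hφ => ?_⟩
  have h := eLpNorm_le_eLpNorm_fderiv_of_eq (volume : Measure (Space N)) (hφ.1.of_le (by simp))
    hφ.2 (p := 2) (p' := (2 * (N : ℝ) / ((N : ℝ) - 2)).toNNReal) (by norm_num)
    (by rw [finrank_euclideanSpace_fin]; omega) ?_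
  · refine h.trans (le_of_eq ?_)
    congr 1
    exact eLpNorm_congr_norm_ae (Eventually.of_forall fun x => (norm_gradient φ x).symm)
  · rw [Real.coe_toNNReal _ (zero_le_two.trans (two_le_sobolev hN)), finrank_euclideanSpace_fin]
    have : (N : ℝ) - 2 ≠ 0 := by linarith
    rw [show (((2 : NNReal)⁻¹ : NNReal) : ℝ) = 2⁻¹ by simp]
    field_simp

/-- The Sobolev inequality for functions with a weak gradient in `L²`. -/
theorem exists_eLpNorm_le_weakGradient (hN : 3 ≤ N) :
    ∃ S : NNReal, ∀ (u : Space N → ℝ) (g : Space N → Space N), Measurable u →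
      StronglyMeasurable g → IsWeakGradient u g → MemLp u (sobolevExponent N) → MemLp g 2 →
      eLpNorm u (sobolevExponent N) ≤ S * eLpNorm g 2 := by
  obtain ⟨S, hS⟩ := exists_eLpNorm_le_gradient_of_isTestFunction hN
  refine ⟨S, fun u g hu hg h hup hg2 => ?_⟩
  have htest := fun n => isTestFunction_approx n h.locallyIntegrable
  have h1 : Tendsto (fun n => S * (eLpNorm (gradient (approx n u) - g) 2 volume +
      eLpNorm g 2 volume)) atTop (nhds (S * (0 + eLpNorm g 2 volume))) :=
    ENNReal.Tendsto.const_mul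
      ((h.tendsto_eLpNorm_gradient_approx_sub hN hu hg hup hg2).add tendsto_const_nhds)
      (Or.inr ENNReal.coe_ne_top)
  rw [zero_add] at h1
  have h3 : ∀ n, eLpNorm (approx n u) (sobolevExponent N) ≤
      S * (eLpNorm (gradient (approx n u) - g) 2 volume + eLpNorm g 2 volume) := by
    intro n
    refine (hS _ (htest n)).trans ?_
    gcongr
    have h2 := eLpNorm_add_le ((htest n).continuous_gradient.aestronglyMeasurable.sub
      hg.aestronglyMeasurable) hg.aestronglyMeasurable one_le_two (μ := volume)
    rwa [sub_add_cancel] at h2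
  -- Almost everywhere convergence suffices on the left side, by Fatou; the right side converges
  -- because the gradients do.
  have h4 := Lp.eLpNorm_lim_le_liminf_eLpNorm (p := sobolevExponent N)
    (fun n => (htest n).1.continuous.aestronglyMeasurable) u
    (ae_tendsto_approx h.locallyIntegrable)
  refine h4.trans ((liminf_le_liminf (Eventually.of_forall h3)).trans ?_)
  exact h1.liminf_eq.le

/-! ### Linearity and closedness of the weak gradient -/

theorem IsWeakGradient.congr {u v : Space N → ℝ} {g k : Space N → Space N}
    (h : IsWeakGradient u g) (huv : u =ᵐ[volume] v) (hgk : g =ᵐ[volume] k) :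
    IsWeakGradient v k := by
  refine ⟨h.locallyIntegrable.congr huv, h.locallyIntegrable_grad.congr hgk, fun φ hφ w => ?_⟩
  have h1 : ∫ x, v x * fderiv ℝ φ x w = ∫ x, u x * fderiv ℝ φ x w :=
    integral_congr_ae (huv.mono fun x hx => by simp only [hx])
  have h2 : ∫ x, inner ℝ (k x) w * φ x = ∫ x, inner ℝ (g x) w * φ x :=
    integral_congr_ae (hgk.mono fun x hx => by simp only [hx])
  rw [h1, h2, h.integral_eq φ hφ w]

theorem IsTestFunction.continuous_fderiv_apply {φ : Space N → ℝ} (hφ : IsTestFunction φ)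
    (v : Space N) : Continuous fun x => fderiv ℝ φ x v :=
  (hφ.1.continuous_fderiv (by simp)).clm_apply continuous_const

theorem IsTestFunction.hasCompactSupport_fderiv_apply {φ : Space N → ℝ} (hφ : IsTestFunction φ)
    (v : Space N) : HasCompactSupport fun x => fderiv ℝ φ x v :=
  hφ.2.fderiv_apply (𝕜 := ℝ) v

theorem integrable_mul_of_hasCompactSupport {u φ : Space N → ℝ} (hu : LocallyIntegrable u)
    (hφ : Continuous φ) (hc : HasCompactSupport φ) : Integrable fun x => u x * φ x :=
  hu.integrable_smul_right_of_hasCompactSupport hφ hc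

theorem LocallyIntegrable.inner_const_right {g : Space N → Space N} (hg : LocallyIntegrable g)
    (v : Space N) : LocallyIntegrable fun x => (inner ℝ (g x) v : ℝ) := by
  intro x
  obtain ⟨s, hs, hi⟩ := hg x
  exact ⟨s, hs, Integrable.inner_const hi v⟩

theorem IsWeakGradient.add {u v : Space N → ℝ} {g k : Space N → Space N}
    (hu : IsWeakGradient u g) (hv : IsWeakGradient v k) : IsWeakGradient (u + v) (g + k) := by
  refine ⟨hu.locallyIntegrable.add hv.locallyIntegrable,
    hu.locallyIntegrable_grad.add hv.locallyIntegrable_grad, fun φ hφ w => ?_⟩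
  have h1 := hφ.continuous_fderiv_apply w
  have h2 := hφ.hasCompactSupport_fderiv_apply w
  simp only [Pi.add_apply, add_mul, inner_add_left]
  rw [integral_add (integrable_mul_of_hasCompactSupport hu.locallyIntegrable h1 h2)
      (integrable_mul_of_hasCompactSupport hv.locallyIntegrable h1 h2),
    integral_add (integrable_mul_of_hasCompactSupport
        (LocallyIntegrable.inner_const_right hu.locallyIntegrable_grad w) hφ.1.continuous hφ.2)
      (integrable_mul_of_hasCompactSupport
        (LocallyIntegrable.inner_const_right hv.locallyIntegrable_grad w) hφ.1.continuous hφ.2),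
    hu.integral_eq φ hφ w, hv.integral_eq φ hφ w, neg_add]

theorem IsWeakGradient.const_smul {u : Space N → ℝ} {g : Space N → Space N}
    (hu : IsWeakGradient u g) (c : ℝ) : IsWeakGradient (c • u) (c • g) := by
  refine ⟨hu.locallyIntegrable.smul c, hu.locallyIntegrable_grad.smul c, fun φ hφ w => ?_⟩
  simp only [Pi.smul_apply, smul_eq_mul, inner_smul_left, conj_trivial, mul_assoc]
  rw [integral_const_mul, integral_const_mul, hu.integral_eq φ hφ w, mul_neg]

theorem IsWeakGradient.sub {u v : Space N → ℝ} {g k : Space N → Space N}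
    (hu : IsWeakGradient u g) (hv : IsWeakGradient v k) : IsWeakGradient (u - v) (g - k) := by
  have := hu.add (hv.const_smul (-1))
  simpa [sub_eq_add_neg] using this

/-- Hölder's inequality: `φ`, being continuous with compact support, lies in the conjugate `L^q`.
This passes both sides of the weak gradient identity to the limit. -/
theorem tendsto_integral_mul_of_tendsto_eLpNorm {p : ℝ≥0∞} (hp : 1 ≤ p)
    {f : ℕ → Space N → ℝ} {u : Space N → ℝ} (hf : ∀ n, MemLp (f n) p) (hu : MemLp u p)
    (h : Tendsto (fun n => eLpNorm (f n - u) p volume) atTop (nhds 0))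
    {φ : Space N → ℝ} (hφ : Continuous φ) (hc : HasCompactSupport φ) :
    Tendsto (fun n => ∫ x, f n x * φ x) atTop (nhds (∫ x, u x * φ x)) := by
  have := ENNReal.HolderConjugate.conjExponent hp
  have hφq : MemLp φ p.conjExponent := hφ.memLp_of_hasCompactSupport hc
  refine tendsto_integral_of_L1' _
    (integrable_mul_of_hasCompactSupport (hu.locallyIntegrable hp) hφ hc).aestronglyMeasurable
    (Eventually.of_forall fun n =>
      integrable_mul_of_hasCompactSupport ((hf n).locallyIntegrable hp) hφ hc) ?_
  have hb : Tendsto (fun n => eLpNorm (f n - u) p volume * eLpNorm φ p.conjExponent volume)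
      atTop (nhds (0 * eLpNorm φ p.conjExponent volume)) :=
    ENNReal.Tendsto.mul_const h (Or.inr hφq.2.ne)
  rw [zero_mul] at hb
  refine tendsto_of_tendsto_of_tendsto_of_le_of_le tendsto_const_nhds hb (fun _ => zero_le)
    fun n => ?_
  have h1 := eLpNorm_smul_le_mul_eLpNorm (r := 1) hφq.1 ((hf n).1.sub hu.1)
    (p := p) (q := p.conjExponent)
  refine le_trans (le_of_eq ?_) h1
  congr 1
  funext x
  simp [sub_mul]

/-- Weak gradients are stable under convergence in `L^p` and `L^q`. -/
theorem IsWeakGradient.of_tendsto {p q : ℝ≥0∞} (hp : 1 ≤ p) (hq : 1 ≤ q) {f : ℕ → Space N → ℝ}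
    {g : ℕ → Space N → Space N} {u : Space N → ℝ} {k : Space N → Space N}
    (h : ∀ n, IsWeakGradient (f n) (g n)) (hf : ∀ n, MemLp (f n) p) (hg : ∀ n, MemLp (g n) q)
    (hu : MemLp u p) (hk : MemLp k q)
    (hfu : Tendsto (fun n => eLpNorm (f n - u) p volume) atTop (nhds 0))
    (hgk : Tendsto (fun n => eLpNorm (g n - k) q volume) atTop (nhds 0)) :
    IsWeakGradient u k := by
  refine ⟨hu.locallyIntegrable hp, hk.locallyIntegrable hq, fun φ hφ v => ?_⟩
  have h1 := tendsto_integral_mul_of_tendsto_eLpNorm hp hf hu hfu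
    (hφ.continuous_fderiv_apply v) (hφ.hasCompactSupport_fderiv_apply v)
  have hgk' : Tendsto (fun n => eLpNorm ((fun x => (inner ℝ (g n x) v : ℝ)) -
      fun x => (inner ℝ (k x) v : ℝ)) q volume) atTop (nhds 0) := by
    have hb := ENNReal.Tendsto.const_mul (a := ‖v‖ₑ) hgk (Or.inr enorm_ne_top)
    rw [mul_zero] at hb
    refine tendsto_of_tendsto_of_tendsto_of_le_of_le tendsto_const_nhds hb (fun _ => zero_le)
      fun n => ?_
    simp only
    rw [← enorm_norm v, ← eLpNorm_const_smul]
    refine eLpNorm_mono fun x => ?_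
    rw [Pi.sub_apply, ← inner_sub_left, Pi.smul_apply, norm_smul, norm_norm, mul_comm]
    exact norm_inner_le_norm _ _
  have h2 := (tendsto_integral_mul_of_tendsto_eLpNorm hq (fun n => (hg n).inner_const v)
    (hk.inner_const v) hgk' hφ.1.continuous hφ.2).neg
  refine tendsto_nhds_unique (h1.congr fun n => ?_) h2
  exact (h n).integral_eq φ hφ v

theorem isWeakGradient_weakGrad {u : Space N → ℝ} (h : ∃ g, IsWeakGradient u g) :
    IsWeakGradient u (weakGrad u) := by
  rw [weakGrad, dif_pos h]
  exact h.choose_spec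

theorem IsWeakGradient.weakGrad_ae_eq {u f : Space N → ℝ} {g : Space N → Space N}
    (h : IsWeakGradient f g) (huf : u =ᵐ[volume] f) : weakGrad u =ᵐ[volume] g :=
  have h' : IsWeakGradient u g := h.congr huf.symm EventuallyEq.rfl
  (isWeakGradient_weakGrad ⟨g, h'⟩).ae_eq h'

theorem MemD12.isWeakGradient {u : Space N → ℝ} (h : MemD12 u) : IsWeakGradient u (weakGrad u) :=
  isWeakGradient_weakGrad ⟨_, h.2.choose_spec.1⟩

theorem MemD12.memLp_weakGrad {u : Space N → ℝ} (h : MemD12 u) : MemLp (weakGrad u) 2 :=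
  (memLp_congr_ae (h.2.choose_spec.1.weakGrad_ae_eq EventuallyEq.rfl)).2 h.2.choose_spec.2

theorem memD12_of_ae_eq {u f : Space N → ℝ} {g : Space N → Space N} (huf : u =ᵐ[volume] f)
    (hf : MemLp f (sobolevExponent N)) (hg : IsWeakGradient f g) (hg2 : MemLp g 2) : MemD12 u :=
  ⟨(memLp_congr_ae huf).2 hf, g, hg.congr huf.symm EventuallyEq.rfl, hg2⟩

/-! ### The two seminorms and the vector space structure -/

/-- The `L²` norm of the weak gradient. -/
noncomputable def weakGradNorm (u : Space N → ℝ) : ℝ := (eLpNorm (weakGrad u) 2 volume).toReal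

/-- The Coulomb norm, the fourth root of the Coulomb energy. -/
noncomputable def coulombNorm (u : Space N → ℝ) : ℝ := (coulombEnergy u ^ (1 / 4 : ℝ)).toReal

theorem weakGradNorm_nonneg (u : Space N → ℝ) : 0 ≤ weakGradNorm u := ENNReal.toReal_nonneg

theorem coulombNorm_nonneg (u : Space N → ℝ) : 0 ≤ coulombNorm u := ENNReal.toReal_nonneg

theorem IsWeakGradient.weakGradNorm_eq {u f : Space N → ℝ} {g : Space N → Space N}
    (h : IsWeakGradient f g) (huf : u =ᵐ[volume] f) :
    weakGradNorm u = (eLpNorm g 2 volume).toReal := by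
  rw [weakGradNorm, eLpNorm_congr_ae (h.weakGrad_ae_eq huf)]

theorem weakGradNorm_sq (u : Space N → ℝ) : weakGradNorm u ^ 2 = (gradEnergy u).toReal := by
  rw [weakGradNorm, eLpNorm_two_eq, ← ENNReal.toReal_pow, ← ENNReal.rpow_natCast,
    ← ENNReal.rpow_mul, gradEnergy]
  norm_num

theorem coulombNorm_pow_four (u : Space N → ℝ) :
    coulombNorm u ^ 4 = (coulombEnergy u).toReal := by
  rw [coulombNorm, ← ENNReal.toReal_pow, ← ENNReal.rpow_natCast, ← ENNReal.rpow_mul]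
  norm_num

theorem normE_eq (u : Space N →ₘ[volume] ℝ) :
    normE u = √(weakGradNorm u ^ 2 + coulombNorm u ^ 2) := by
  rw [normE, weakGradNorm_sq, ← coulombNorm_pow_four,
    show coulombNorm u ^ 4 = (coulombNorm u ^ 2) ^ 2 by ring, Real.sqrt_sq (sq_nonneg _)]

theorem normE_sq (u : Space N →ₘ[volume] ℝ) :
    normE u ^ 2 = weakGradNorm u ^ 2 + coulombNorm u ^ 2 := by
  rw [normE_eq, Real.sq_sqrt (by positivity)]

theorem normE_le (u : Space N →ₘ[volume] ℝ) : normE u ≤ weakGradNorm u + coulombNorm u := by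
  rw [normE_eq]
  refine Real.sqrt_le_iff.2 ⟨add_nonneg (weakGradNorm_nonneg _) (coulombNorm_nonneg _), ?_⟩
  nlinarith [mul_nonneg (weakGradNorm_nonneg u) (coulombNorm_nonneg u)]

theorem weakGradNorm_le_normE (u : Space N →ₘ[volume] ℝ) : weakGradNorm u ≤ normE u := by
  rw [normE_eq]
  exact Real.le_sqrt_of_sq_le (by linarith [sq_nonneg (coulombNorm u)])

theorem coulombNorm_le_normE (u : Space N →ₘ[volume] ℝ) : coulombNorm u ≤ normE u := by
  rw [normE_eq]
  exact Real.le_sqrt_of_sq_le (by linarith [sq_nonneg (weakGradNorm u)])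

theorem coulombNorm_congr {u v : Space N → ℝ} (h : u =ᵐ[volume] v) :
    coulombNorm u = coulombNorm v := by
  rw [coulombNorm, coulombNorm, coulombEnergy_congr h]

theorem measurable_coe (u : Space N →ₘ[volume] ℝ) : Measurable (u : Space N → ℝ) :=
  u.stronglyMeasurable.measurable

theorem mem_spaceE_of_isTestFunction (hN : 3 ≤ N) {u : Space N →ₘ[volume] ℝ} {φ : Space N → ℝ}
    (hφ : IsTestFunction φ) (h : u =ᵐ[volume] φ) : u ∈ spaceE N :=
  ⟨memD12_of_ae_eq h (hφ.memLp _) hφ.isWeakGradient_gradient (hφ.memLp_gradient 2), by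
    rw [coulombEnergy_congr h]; exact hφ.coulombEnergy_lt_top hN⟩

theorem add_mem_spaceE (hN : 3 ≤ N) {u v : Space N →ₘ[volume] ℝ} (hu : u ∈ spaceE N)
    (hv : v ∈ spaceE N) : u + v ∈ spaceE N := by
  have h := AEEqFun.coeFn_add u v
  refine ⟨memD12_of_ae_eq h (hu.1.1.add hv.1.1) (hu.1.isWeakGradient.add hv.1.isWeakGradient)
    (hu.1.memLp_weakGrad.add hv.1.memLp_weakGrad), ?_⟩
  rw [coulombEnergy_congr h]
  exact (le_self_add.trans (coulombEnergy_add_add_sub_le hN (measurable_coe u)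
    (measurable_coe v))).trans_lt (ENNReal.mul_lt_top (by norm_num)
      (ENNReal.add_lt_top.2 ⟨hu.2, hv.2⟩))

theorem smul_mem_spaceE {u : Space N →ₘ[volume] ℝ} (hu : u ∈ spaceE N) (c : ℝ) :
    c • u ∈ spaceE N := by
  have h := AEEqFun.coeFn_smul c u
  refine ⟨memD12_of_ae_eq h (hu.1.1.const_smul c) (hu.1.isWeakGradient.const_smul c)
    (hu.1.memLp_weakGrad.const_smul c), ?_⟩
  rw [coulombEnergy_congr h]
  exact (coulombEnergy_const_smul c u).trans_lt (ENNReal.mul_lt_top ENNReal.ofReal_lt_top hu.2)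

theorem zero_mem_spaceE (hN : 3 ≤ N) : (0 : Space N →ₘ[volume] ℝ) ∈ spaceE N :=
  mem_spaceE_of_isTestFunction hN (φ := 0) ⟨contDiff_const, HasCompactSupport.zero⟩
    AEEqFun.coeFn_zero

/-- `E(ℝ^N)` as a vector space. -/
def submoduleE (hN : 3 ≤ N) : Submodule ℝ (Space N →ₘ[volume] ℝ) where
  carrier := spaceE N
  add_mem' hu hv := add_mem_spaceE hN hu hv
  zero_mem' := zero_mem_spaceE hN
  smul_mem' c _ hu := smul_mem_spaceE hu c

theorem sub_mem_spaceE (hN : 3 ≤ N) {u v : Space N →ₘ[volume] ℝ} (hu : u ∈ spaceE N)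
    (hv : v ∈ spaceE N) : u - v ∈ spaceE N :=
  (submoduleE hN).sub_mem hu hv

theorem weakGrad_add_ae_eq {u v : Space N →ₘ[volume] ℝ} (hu : u ∈ spaceE N) (hv : v ∈ spaceE N) :
    weakGrad (u + v : Space N →ₘ[volume] ℝ) =ᵐ[volume] weakGrad u + weakGrad v :=
  (hu.1.isWeakGradient.add hv.1.isWeakGradient).weakGrad_ae_eq (AEEqFun.coeFn_add u v)

theorem weakGrad_sub_ae_eq {u v : Space N →ₘ[volume] ℝ} (hu : u ∈ spaceE N) (hv : v ∈ spaceE N) :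
    weakGrad (u - v : Space N →ₘ[volume] ℝ) =ᵐ[volume] weakGrad u - weakGrad v :=
  (hu.1.isWeakGradient.sub hv.1.isWeakGradient).weakGrad_ae_eq (AEEqFun.coeFn_sub u v)

theorem weakGradNorm_add_le {u v : Space N →ₘ[volume] ℝ} (hu : u ∈ spaceE N) (hv : v ∈ spaceE N) :
    weakGradNorm (u + v : Space N →ₘ[volume] ℝ) ≤ weakGradNorm u + weakGradNorm v := by
  have h1 := hu.1.memLp_weakGrad
  have h2 := hv.1.memLp_weakGrad
  rw [weakGradNorm, eLpNorm_congr_ae (weakGrad_add_ae_eq hu hv), weakGradNorm, weakGradNorm,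
    ← ENNReal.toReal_add h1.2.ne h2.2.ne]
  exact ENNReal.toReal_mono (ENNReal.add_ne_top.2 ⟨h1.2.ne, h2.2.ne⟩)
    (eLpNorm_add_le h1.1 h2.1 one_le_two)

theorem weakGradNorm_smul {u : Space N →ₘ[volume] ℝ} (hu : u ∈ spaceE N) (c : ℝ) :
    weakGradNorm (c • u : Space N →ₘ[volume] ℝ) = |c| * weakGradNorm u := by
  rw [(hu.1.isWeakGradient.const_smul c).weakGradNorm_eq (AEEqFun.coeFn_smul c u),
    eLpNorm_const_smul, ENNReal.toReal_mul, weakGradNorm, toReal_enorm, Real.norm_eq_abs]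

theorem coulombNorm_smul (u : Space N →ₘ[volume] ℝ) (c : ℝ) :
    coulombNorm (c • u : Space N →ₘ[volume] ℝ) = |c| * coulombNorm u := by
  rw [coulombNorm_congr (AEEqFun.coeFn_smul c u), coulombNorm,
    show coulombEnergy (c • (u : Space N → ℝ)) = _ from coulombEnergy_const_smul c u,
    ENNReal.mul_rpow_of_nonneg _ _ (by norm_num), ENNReal.toReal_mul, coulombNorm,
    ENNReal.ofReal_rpow_of_nonneg (by positivity) (by norm_num),
    ENNReal.toReal_ofReal (by positivity), ← abs_of_nonneg (by positivity : 0 ≤ c ^ 4), abs_pow,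
    ← Real.rpow_natCast, ← Real.rpow_mul (abs_nonneg c)]
  norm_num

theorem coulombNorm_add_le (hN : 3 ≤ N) {u v : Space N →ₘ[volume] ℝ} (hu : u ∈ spaceE N)
    (hv : v ∈ spaceE N) :
    coulombNorm (u + v : Space N →ₘ[volume] ℝ) ≤ coulombNorm u + coulombNorm v := by
  have h1 : coulombEnergy u ^ (1 / 4 : ℝ) ≠ ⊤ :=
    ENNReal.rpow_ne_top_of_nonneg (by norm_num) hu.2.ne
  have h2 : coulombEnergy v ^ (1 / 4 : ℝ) ≠ ⊤ :=
    ENNReal.rpow_ne_top_of_nonneg (by norm_num) hv.2.ne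
  rw [coulombNorm_congr (AEEqFun.coeFn_add u v), coulombNorm, coulombNorm, coulombNorm,
    ← ENNReal.toReal_add h1 h2]
  exact ENNReal.toReal_mono (ENNReal.add_ne_top.2 ⟨h1, h2⟩)
    (coulombEnergy_add_rpow_le hN (measurable_coe u) (measurable_coe v))

theorem coulombNorm_clarkson (hN : 3 ≤ N) {u v : Space N →ₘ[volume] ℝ} (hu : u ∈ spaceE N)
    (hv : v ∈ spaceE N) :
    coulombNorm (u + v : Space N →ₘ[volume] ℝ) ^ 4 + coulombNorm (u - v : Space N →ₘ[volume] ℝ) ^ 4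
      ≤ 8 * (coulombNorm u ^ 4 + coulombNorm v ^ 4) := by
  have h := coulombEnergy_add_add_sub_le hN (measurable_coe u) (measurable_coe v)
  rw [← coulombEnergy_congr (AEEqFun.coeFn_add u v),
    ← coulombEnergy_congr (AEEqFun.coeFn_sub u v)] at h
  have h' := ENNReal.toReal_mono (ENNReal.mul_ne_top (by norm_num)
    (ENNReal.add_ne_top.2 ⟨hu.2.ne, hv.2.ne⟩)) h
  rw [ENNReal.toReal_add (add_mem_spaceE hN hu hv).2.ne (sub_mem_spaceE hN hu hv).2.ne,
    ENNReal.toReal_mul, ENNReal.toReal_add hu.2.ne hv.2.ne] at h'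
  simpa only [coulombNorm_pow_four, ENNReal.toReal_ofNat] using h'

theorem weakGradNorm_parallelogram {u v : Space N →ₘ[volume] ℝ} (hu : u ∈ spaceE N)
    (hv : v ∈ spaceE N) :
    weakGradNorm (u + v : Space N →ₘ[volume] ℝ) ^ 2 +
      weakGradNorm (u - v : Space N →ₘ[volume] ℝ) ^ 2 =
      2 * (weakGradNorm u ^ 2 + weakGradNorm v ^ 2) := by
  have h1 := hu.1.memLp_weakGrad
  have h2 := hv.1.memLp_weakGrad
  have key : ∀ (w : Space N → ℝ) {g : Space N → Space N} (hg : MemLp g 2),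
      weakGrad w =ᵐ[volume] g → weakGradNorm w = ‖hg.toLp g‖ := by
    intro w g hg h
    rw [Lp.norm_toLp, weakGradNorm, eLpNorm_congr_ae h]
  rw [key _ (h1.add h2) (weakGrad_add_ae_eq hu hv), key _ (h1.sub h2) (weakGrad_sub_ae_eq hu hv),
    key _ h1 EventuallyEq.rfl, key _ h2 EventuallyEq.rfl, MemLp.toLp_add h1 h2, MemLp.toLp_sub h1 h2]
  exact parallelogram_law_with_norm ℝ (h1.toLp (weakGrad u)) (h2.toLp (weakGrad v))

/-! ### The norm on `E` and approximation in norm -/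

/-- The Sobolev inequality on `E(ℝ^N)`. -/
theorem exists_eLpNorm_le_weakGrad (hN : 3 ≤ N) : ∃ S : NNReal, ∀ u ∈ spaceE N,
    eLpNorm u (sobolevExponent N) volume ≤ S * eLpNorm (weakGrad u) 2 volume := by
  obtain ⟨S, hS⟩ := exists_eLpNorm_le_weakGradient hN
  refine ⟨S, fun u hu => ?_⟩
  have h1 := hu.1.memLp_weakGrad
  have h2 := h1.1.ae_eq_mk
  rw [eLpNorm_congr_ae h2]
  exact hS u _ (measurable_coe u) h1.1.stronglyMeasurable_mk
    (hu.1.isWeakGradient.congr EventuallyEq.rfl h2) hu.1.1 ((memLp_congr_ae h2).1 h1)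

theorem normE_smul {u : Space N →ₘ[volume] ℝ} (hu : u ∈ spaceE N) (c : ℝ) :
    normE (c • u) = ‖c‖ * normE u := by
  rw [normE_eq, normE_eq, weakGradNorm_smul hu, coulombNorm_smul, mul_pow, mul_pow, ← mul_add,
    Real.sqrt_mul (by positivity), Real.sqrt_sq (abs_nonneg c), Real.norm_eq_abs]

theorem normE_add_le (hN : 3 ≤ N) {u v : Space N →ₘ[volume] ℝ} (hu : u ∈ spaceE N)
    (hv : v ∈ spaceE N) : normE (u + v) ≤ normE u + normE v := by
  rw [normE_eq, normE_eq, normE_eq]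
  exact sqrt_add_sq_le_of_le (weakGradNorm_nonneg _) (coulombNorm_nonneg _)
    (weakGradNorm_add_le hu hv) (coulombNorm_add_le hN hu hv)

theorem eq_zero_of_normE_eq_zero (hN : 3 ≤ N) {u : Space N →ₘ[volume] ℝ} (hu : u ∈ spaceE N)
    (h : normE u = 0) : u = 0 := by
  obtain ⟨S, hS⟩ := exists_eLpNorm_le_weakGrad hN
  have h1 : weakGradNorm u = 0 :=
    le_antisymm ((weakGradNorm_le_normE u).trans h.le) (weakGradNorm_nonneg _)
  have h2 : eLpNorm (weakGrad u) 2 volume = 0 :=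
    ((ENNReal.toReal_eq_zero_iff _).1 h1).resolve_right hu.1.memLp_weakGrad.2.ne
  have h3 := hS u hu
  rw [h2, mul_zero, nonpos_iff_eq_zero, eLpNorm_eq_zero_iff hu.1.1.1
    (zero_lt_two.trans_le (two_le_sobolevExponent hN)).ne'] at h3
  exact AEEqFun.ext (h3.trans AEEqFun.coeFn_zero.symm)

theorem coulombEnergy_sub_comm (u v : Space N → ℝ) :
    coulombEnergy (u - v) = coulombEnergy (v - u) := by
  unfold coulombEnergy
  simp_rw [Pi.sub_apply, sub_sq_comm]

/-- Test functions approximate the elements of `E(ℝ^N)`. -/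
theorem exists_normE_sub_approx_lt (hN : 3 ≤ N) {u : Space N →ₘ[volume] ℝ} (hu : u ∈ spaceE N)
    {ε : ℝ} (hε : 0 < ε) :
    ∃ (n : ℕ) (v : Space N →ₘ[volume] ℝ), v =ᵐ[volume] approx n u ∧ normE (u - v) < ε := by
  have h1 := hu.1.memLp_weakGrad
  have h2 := h1.1.ae_eq_mk
  -- The chosen weak gradient is only almost everywhere strongly measurable, while the convergence
  -- results need a strongly measurable representative.
  set g := h1.1.mk (weakGrad u)
  have hg := h1.1.stronglyMeasurable_mk
  have hw : IsWeakGradient u g := hu.1.isWeakGradient.congr EventuallyEq.rfl h2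
  have hg2 : MemLp g 2 := (memLp_congr_ae h2).1 h1
  have htest := fun n => isTestFunction_approx n hw.locallyIntegrable
  have t1 := hw.tendsto_eLpNorm_gradient_approx_sub hN (measurable_coe u) hg hu.1.1 hg2
  have t2 := (tendsto_coulombEnergy_approx_sub hN (measurable_coe u) hw.locallyIntegrable
    hu.2.ne).ennrpow_const (1 / 4)
  rw [ENNReal.zero_rpow_of_pos (by norm_num)] at t2
  have t3 := ((ENNReal.tendsto_toReal ENNReal.zero_ne_top).comp t1).add
    ((ENNReal.tendsto_toReal ENNReal.zero_ne_top).comp t2)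
  rw [ENNReal.toReal_zero, add_zero] at t3
  obtain ⟨n, hn⟩ := (t3.eventually_lt_const hε).exists
  have hm := (htest n).1.continuous.aestronglyMeasurable (μ := volume)
  refine ⟨n, AEEqFun.mk _ hm, AEEqFun.coeFn_mk _ hm, lt_of_le_of_lt (normE_le _) ?_⟩
  have hsub : (u - AEEqFun.mk _ hm : Space N →ₘ[volume] ℝ) =ᵐ[volume] u - approx n u :=
    (AEEqFun.coeFn_sub _ _).trans (EventuallyEq.rfl.sub (AEEqFun.coeFn_mk _ hm))
  rw [(hw.sub (htest n).isWeakGradient_gradient).weakGradNorm_eq hsub, eLpNorm_sub_comm,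
    coulombNorm_congr hsub, coulombNorm, coulombEnergy_sub_comm]
  exact hn

/-! ### Completeness -/

/-- Reduces completeness to a statement about the bare norm, so that the estimates on `normE` never
involve the metric built by `NormedAddCommGroup.ofCore`. -/
theorem completeSpace_ofCore {V : Type*} [AddCommGroup V] [Module ℝ V] [Norm V]
    (core : NormedSpace.Core ℝ V)
    (h : ∀ u : ℕ → V, (∀ ε > 0, ∃ n₀, ∀ m ≥ n₀, ∀ n ≥ n₀, ‖u m - u n‖ < ε) →
      ∃ v, ∀ ε > 0, ∃ n₀, ∀ n ≥ n₀, ‖u n - v‖ < ε) :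
    letI : NormedAddCommGroup V := NormedAddCommGroup.ofCore core
    CompleteSpace V := by
  let _ : NormedAddCommGroup V := NormedAddCommGroup.ofCore core
  refine Metric.complete_of_cauchySeq_tendsto fun u hu => ?_
  obtain ⟨v, hv⟩ := h u fun ε hε => by
    obtain ⟨n₀, hn⟩ := Metric.cauchySeq_iff.1 hu ε hε
    exact ⟨n₀, fun m hm n hn' => by rw [← dist_eq_norm]; exact hn m hm n hn'⟩
  refine ⟨v, Metric.tendsto_atTop.2 fun ε hε => ?_⟩
  obtain ⟨n₀, hn⟩ := hv ε hε
  exact ⟨n₀, fun n hn' => by rw [dist_eq_norm]; exact hn n hn'⟩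

theorem mem_closure_ofCore {V : Type*} [AddCommGroup V] [Module ℝ V] [Norm V]
    (core : NormedSpace.Core ℝ V) {s : Set V} {u : V} (h : ∀ ε > 0, ∃ v ∈ s, ‖u - v‖ < ε) :
    letI : NormedAddCommGroup V := NormedAddCommGroup.ofCore core
    u ∈ closure s := by
  let _ : NormedAddCommGroup V := NormedAddCommGroup.ofCore core
  refine Metric.mem_closure_iff.2 fun ε hε => ?_
  obtain ⟨v, hv, hlt⟩ := h ε hε
  exact ⟨v, hv, by rw [dist_eq_norm]; exact hlt⟩

theorem exists_tendsto_eLpNorm_of_cauchy {α F : Type*} [MeasurableSpace α] {μ : Measure α}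
    [NormedAddCommGroup F] [CompleteSpace F] {p : ℝ≥0∞} (hp : 1 ≤ p) {f : ℕ → α → F}
    (hf : ∀ n, MemLp (f n) p μ)
    (h : ∀ ε > 0, ∃ n₀, ∀ m ≥ n₀, ∀ n ≥ n₀, (eLpNorm (f m - f n) p μ).toReal < ε) :
    ∃ g, StronglyMeasurable g ∧ MemLp g p μ ∧
      Tendsto (fun n => eLpNorm (f n - g) p μ) atTop (nhds 0) := by
  have : Fact (1 ≤ p) := ⟨hp⟩
  have hc : CauchySeq fun n => (hf n).toLp (f n) := by
    refine Metric.cauchySeq_iff.2 fun ε hε => ?_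
    obtain ⟨n₀, hn⟩ := h ε hε
    refine ⟨n₀, fun m hm n hn' => ?_⟩
    rw [dist_eq_norm, ← MemLp.toLp_sub (hf m) (hf n), Lp.norm_toLp]
    exact hn m hm n hn'
  obtain ⟨g, hg⟩ := cauchySeq_tendsto_of_complete hc
  refine ⟨g, Lp.stronglyMeasurable g, Lp.memLp g, ?_⟩
  refine ((Lp.tendsto_Lp_iff_tendsto_eLpNorm' _ _).1 hg).congr fun n => ?_
  exact eLpNorm_congr_ae ((hf n).coeFn_toLp.sub EventuallyEq.rfl)

/-- Sobolev supplies a limit `f` of the functions and completeness of `L²` a limit of the gradients.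
The Coulomb part needs no completeness of its own: Fatou along an almost everywhere convergent
subsequence transfers the Cauchy bound to `u n - f`. -/
theorem exists_limit_of_cauchy_normE (hN : 3 ≤ N) {u : ℕ → Space N →ₘ[volume] ℝ}
    (hu : ∀ n, u n ∈ spaceE N)
    (h : ∀ ε > 0, ∃ n₀, ∀ m ≥ n₀, ∀ n ≥ n₀, normE (u m - u n) < ε) :
    ∃ v ∈ spaceE N, ∀ ε > 0, ∃ n₀, ∀ n ≥ n₀, normE (u n - v) < ε := by
  obtain ⟨S, hS⟩ := exists_eLpNorm_le_weakGrad hN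
  have hp1 : 1 ≤ sobolevExponent N := one_le_two.trans (two_le_sobolevExponent hN)
  have hmem := fun m n => sub_mem_spaceE hN (hu m) (hu n)
  obtain ⟨f, hfm, hfp, hf⟩ := exists_tendsto_eLpNorm_of_cauchy hp1 (fun n => (hu n).1.1) <| by
    intro ε hε
    -- The `+ 1` keeps the denominator positive when `S = 0`.
    obtain ⟨n₀, hn₀⟩ := h (ε / (S + 1)) (by positivity)
    refine ⟨n₀, fun m hm n hn => ?_⟩
    have h1 := hS _ (hmem m n)
    rw [eLpNorm_congr_ae (AEEqFun.coeFn_sub _ _)] at h1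
    have h2 := ENNReal.toReal_mono
      (ENNReal.mul_ne_top ENNReal.coe_ne_top (hmem m n).1.memLp_weakGrad.2.ne) h1
    rw [ENNReal.toReal_mul, ENNReal.coe_toReal] at h2
    have h3 := (weakGradNorm_le_normE _).trans_lt (hn₀ m hm n hn)
    rw [lt_div_iff₀ (by positivity)] at h3
    have h4 := weakGradNorm_nonneg (u m - u n : Space N →ₘ[volume] ℝ)
    refine h2.trans_lt (lt_of_le_of_lt ?_ h3)
    rw [mul_comm]
    change weakGradNorm _ * _ ≤ _
    gcongr
    linarith
  obtain ⟨g, -, hg2, hg⟩ := exists_tendsto_eLpNorm_of_cauchy one_le_two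
      (fun n => (hu n).1.memLp_weakGrad) <| by
    intro ε hε
    obtain ⟨n₀, hn₀⟩ := h ε hε
    refine ⟨n₀, fun m hm n hn => ?_⟩
    rw [← eLpNorm_congr_ae (weakGrad_sub_ae_eq (hu m) (hu n))]
    exact (weakGradNorm_le_normE _).trans_lt (hn₀ m hm n hn)
  have hw : IsWeakGradient f g := IsWeakGradient.of_tendsto hp1 one_le_two
    (fun n => (hu n).1.isWeakGradient) (fun n => (hu n).1.1) (fun n => (hu n).1.memLp_weakGrad)
    hfp hg2 hf hg
  obtain ⟨ns, hns, hae⟩ := (tendstoInMeasure_of_tendsto_eLpNorm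
    (zero_lt_one.trans_le hp1).ne' (fun n => (hu n).1.1.1) hfp.1 hf).exists_seq_tendsto_ae
  have hfm' : Measurable f := hfm.measurable
  have hC : ∀ ε : ℝ, 0 < ε → ∃ n₀, ∀ n ≥ n₀,
      coulombEnergy ((u n : Space N → ℝ) - f) ≤ ENNReal.ofReal (ε ^ 4) := by
    intro ε hε
    obtain ⟨n₀, hn₀⟩ := h ε hε
    refine ⟨n₀, fun n hn => ?_⟩
    refine (coulombEnergy_le_liminf (v := fun k => (u n : Space N → ℝ) - (u (ns k) : Space N → ℝ))
      (fun k => (measurable_coe _).sub (measurable_coe _)) ?_).trans ?_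
    · filter_upwards [hae] with x hx
      exact tendsto_const_nhds.sub hx
    · refine liminf_le_of_le (by isBoundedDefault) fun b hb => ?_
      obtain ⟨k, hk, hk'⟩ := (hb.and (hns.tendsto_atTop.eventually_ge_atTop n₀)).exists
      refine hk.trans ?_
      rw [← coulombEnergy_congr (AEEqFun.coeFn_sub _ _),
        ← ENNReal.ofReal_toReal (hmem n (ns k)).2.ne, ← coulombNorm_pow_four]
      have := (coulombNorm_le_normE _).trans_lt (hn₀ n hn (ns k) hk')
      exact ENNReal.ofReal_le_ofReal (pow_le_pow_left₀ (coulombNorm_nonneg _) this.le 4)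
  set v : Space N →ₘ[volume] ℝ := AEEqFun.mk f hfp.1 with hv
  have hvf : v =ᵐ[volume] f := AEEqFun.coeFn_mk _ _
  have hsub : ∀ n, (u n - v : Space N →ₘ[volume] ℝ) =ᵐ[volume] (u n : Space N → ℝ) - f :=
    fun n => (AEEqFun.coeFn_sub _ _).trans (EventuallyEq.rfl.sub hvf)
  have hvE : v ∈ spaceE N := by
    refine ⟨memD12_of_ae_eq hvf hfp hw hg2, ?_⟩
    obtain ⟨n, hn⟩ := hC 1 one_pos
    have hn := hn n le_rfl
    -- Clarkson is applied to `u n` and `u n - f`, both of finite energy, because their difference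
    -- is `f`.
    have h1 := coulombEnergy_add_add_sub_le hN (measurable_coe (u n))
      ((measurable_coe (u n)).sub hfm')
    rw [sub_sub_cancel] at h1
    rw [coulombEnergy_congr hvf]
    refine (le_add_self.trans h1).trans_lt (ENNReal.mul_lt_top (by norm_num)
      (ENNReal.add_lt_top.2 ⟨(hu n).2, hn.trans_lt ENNReal.ofReal_lt_top⟩))
  refine ⟨v, hvE, fun ε hε => ?_⟩
  obtain ⟨n₁, hn₁⟩ := hC (ε / 2) (by positivity)
  have t := (ENNReal.tendsto_toReal ENNReal.zero_ne_top).comp hg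
  rw [ENNReal.toReal_zero] at t
  obtain ⟨n₂, hn₂⟩ := eventually_atTop.1 (t.eventually_lt_const (half_pos hε))
  refine ⟨max n₁ n₂, fun n hn => ?_⟩
  have h1 : coulombNorm (u n - v : Space N →ₘ[volume] ℝ) ≤ ε / 2 := by
    refine le_of_pow_le_pow_left₀ (n := 4) (by norm_num) (by positivity) ?_
    rw [coulombNorm_pow_four, coulombEnergy_congr (hsub n)]
    exact ENNReal.toReal_le_of_le_ofReal (by positivity) (hn₁ n (le_of_max_le_left hn))
  have h2 : weakGradNorm (u n - v : Space N →ₘ[volume] ℝ) < ε / 2 := by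
    rw [((hu n).1.isWeakGradient.sub hw).weakGradNorm_eq (hsub n)]
    exact hn₂ n (le_of_max_le_right hn)
  linarith [normE_le (u n - v)]

/-! ### The main theorem -/

theorem proposition2p1 (N : ℕ) (hN : 3 ≤ N) :
    testClasses N ⊆ spaceE N ∧ radialTestClasses N ⊆ spaceEr N ∧
    ∃ V : Submodule ℝ (Space N →ₘ[volume] ℝ), (V : Set (Space N →ₘ[volume] ℝ)) = spaceE N ∧
      letI : Norm V := ⟨fun u => normE (u : Space N →ₘ[volume] ℝ)⟩
      -- `normE` is a norm on the vector space `V = E(ℝ^N)`; what follows is for this norm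
      ∃ core : NormedSpace.Core ℝ V,
        letI : NormedAddCommGroup V := NormedAddCommGroup.ofCore core
        CompleteSpace V ∧
        UniformConvexSpace V ∧
        Dense {u : V | (u : Space N →ₘ[volume] ℝ) ∈ testClasses N} ∧
        {u : V | (u : Space N →ₘ[volume] ℝ) ∈ spaceEr N} ⊆
          closure {u : V | (u : Space N →ₘ[volume] ℝ) ∈ radialTestClasses N} := by
  refine ⟨fun u ⟨φ, hφ, h⟩ => mem_spaceE_of_isTestFunction hN hφ h,
    fun u ⟨φ, hφ, hr, h⟩ => ⟨mem_spaceE_of_isTestFunction hN hφ h, φ, hr, h⟩,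
    submoduleE hN, rfl, ?_⟩
  let _ : Norm (submoduleE hN) := ⟨fun u => normE (u : Space N →ₘ[volume] ℝ)⟩
  have core : NormedSpace.Core ℝ (submoduleE hN) :=
    { norm_nonneg := fun u => Real.sqrt_nonneg _
      norm_smul := fun c u => normE_smul u.2 c
      norm_triangle := fun u v => normE_add_le hN u.2 v.2
      norm_eq_zero_iff := fun u => by
        refine ⟨fun h => Subtype.ext (eq_zero_of_normE_eq_zero hN u.2 h), ?_⟩
        rintro rfl
        -- Homogeneity with the scalar `0` gives the norm of the zero class without computing its
        -- energies.
        have := normE_smul (zero_mem_spaceE hN) 0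
        rwa [zero_smul, norm_zero, zero_mul] at this }
  have happrox : ∀ u : submoduleE hN, ∀ ε > 0, ∃ (n : ℕ) (v : submoduleE hN),
      (v : Space N →ₘ[volume] ℝ) =ᵐ[volume] approx n (u : Space N →ₘ[volume] ℝ) ∧
        ‖u - v‖ < ε := by
    intro u ε hε
    obtain ⟨n, v, hv, hlt⟩ := exists_normE_sub_approx_lt hN u.2 hε
    exact ⟨n, ⟨v, mem_spaceE_of_isTestFunction hN
      (isTestFunction_approx n u.2.1.isWeakGradient.locallyIntegrable) hv⟩, hv, hlt⟩
  refine ⟨core, completeSpace_ofCore core fun u hu => ?_,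
    uniformConvexSpace_ofCore core (fun u => weakGradNorm (u : Space N →ₘ[volume] ℝ))
      (fun u => coulombNorm (u : Space N →ₘ[volume] ℝ)) (fun u => coulombNorm_nonneg _)
      (fun u => normE_sq _) (fun u v => weakGradNorm_parallelogram u.2 v.2)
      (fun u v => coulombNorm_add_le hN u.2 v.2) (fun u v => coulombNorm_clarkson hN u.2 v.2),
    fun u => mem_closure_ofCore core fun ε hε => ?_,
    fun u hu => mem_closure_ofCore core fun ε hε => ?_⟩
  · obtain ⟨v, hv, h⟩ := exists_limit_of_cauchy_normE hN (fun n => (u n).2) hu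
    exact ⟨⟨v, hv⟩, h⟩
  · obtain ⟨n, v, hv, hlt⟩ := happrox u ε hε
    exact ⟨v, ⟨_, isTestFunction_approx n u.2.1.isWeakGradient.locallyIntegrable, hv⟩, hlt⟩
  · obtain ⟨n, v, hv, hlt⟩ := happrox u ε hε
    obtain ⟨-, f, hf, huf⟩ := hu
    exact ⟨v, ⟨_, isTestFunction_approx n u.2.1.isWeakGradient.locallyIntegrable,
      isRadial_approx huf hf n, hv⟩, hlt⟩
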